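/- Let $q,a,b,c,d$ be non-zero complex numbers with $|q|<1$ and $ef\notin q^{\mathbb Z}$ for all $e,f\in\{a,b,c,d\}$ (the case $e=f$ included). Write $$(z;q)_\infty=\prod_{k=0}^\infty(1-zq^k),\qquad (z_1,\dots,z_r;q)_\infty=\prod_{j=1}^r(z_j;q)_\infty,$$ $$\Delta_+(x)=\frac{(x^2,x^{-2};q)_\infty}{(ax,ax^{-1},bx,bx^{-1},cx,cx^{-1},dx,dx^{-1};q)_\infty}.$$ Let $C\subset\mathbb C$ be any rectifiable Jordan curve, oriented counterclockwise, with $0$ and the points $eq^k$ in its interior and the points $e^{-1}q^{-k}$ in its exterior, for all $e\in\{a,b,c,d\}$ and $k\in\{0,1,2,\dots\}$, and put $$(f,g)_{a,b,c,d}=\frac1{2\pi i}\int_{C}f(x)\,g(x^{-1})\,\Delta_+(x)\,\frac{dx}{x}.$$ Then the constant term (the Askey–Wilson integral) is $$(1,1)_{a,b,c,d}=\frac{2\,(abcd;q)_\infty}{(q,ab,ac,ad,bc,bd,cd;q)_\infty}.$$ -/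

import Mathlib

open scoped Real

namespace AskeyWilson

noncomputable section

/-- The infinite `q`-shifted factorial `(z; q)_∞ = ∏_{k ≥ 0} (1 - z q^k)`. -/
def qfac (q z : ℂ) : ℂ := ∏' k : ℕ, (1 - z * q ^ k)

/-- A (parametrized) rectifiable Jordan curve in the complex plane: a simple closed curve
parametrized by `[0, 1]`. A curve has finite length exactly when it can be parametrized by a
Lipschitz map (proportionally to arc length), so rectifiability is expressed by asking the
parametrization to be Lipschitz; only the values on `[0, 1]` matter. -/
structure JordanCurve where
  param : ℝ → ℂ
  lipschitz : ∃ K : NNReal, LipschitzOnWith K param (Set.Icc 0 1)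
  closed : param 0 = param 1
  simple : Set.InjOn param (Set.Ico 0 1)

namespace JordanCurve

/-- The curve as a subset of the plane. -/
def trace (C : JordanCurve) : Set ℂ := C.param '' Set.Icc 0 1

/-- The interior of the curve: the union of the bounded connected components of the
complement of the curve. -/
def inside (C : JordanCurve) : Set ℂ :=
  {z | z ∉ C.trace ∧ Bornology.IsBounded (connectedComponentIn C.traceᶜ z)}

/-- The exterior of the curve: the union of the unbounded connected components of the
complement of the curve. -/
def outside (C : JordanCurve) : Set ℂ :=
  {z | z ∉ C.trace ∧ ¬ Bornology.IsBounded (connectedComponentIn C.traceᶜ z)}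

/-- The contour integral `∫_C f(x) dx`, in the direction of the parametrization. A Lipschitz
parametrization is differentiable almost everywhere and is the integral of its derivative. -/
def integral (C : JordanCurve) (f : ℂ → ℂ) : ℂ :=
  ∫ t in (0 : ℝ)..1, f (C.param t) * deriv C.param t

/-- The curve is traversed counterclockwise: it winds once, in the positive direction,
around each point of its interior. -/
def Counterclockwise (C : JordanCurve) : Prop :=
  ∀ z ∈ C.inside, 1 / (2 * π * Complex.I) * C.integral (fun x => 1 / (x - z)) = 1

end JordanCurve

/-- The contours used for the parameters `a, b, c, d`: counterclockwise rectifiable Jordan curves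
with `0` and all points `e q^k` in the interior, and all points `e⁻¹ q^{-k}` in the
exterior, for `e ∈ {a, b, c, d}` and `k ≥ 0`. -/
structure IsContour (q a b c d : ℂ) (C : JordanCurve) : Prop where
  counterclockwise : C.Counterclockwise
  zero_inside : (0 : ℂ) ∈ C.inside
  mem_inside : ∀ e ∈ ({a, b, c, d} : Set ℂ), ∀ k : ℕ, e * q ^ k ∈ C.inside
  mem_outside : ∀ e ∈ ({a, b, c, d} : Set ℂ), ∀ k : ℕ, e⁻¹ * (q ^ k)⁻¹ ∈ C.outside

/-- The weight function `Δ₊(x)`. -/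
def weight (q a b c d x : ℂ) : ℂ :=
  (qfac q (x ^ 2) * qfac q (x⁻¹ ^ 2)) /
    (qfac q (a * x) * qfac q (a * x⁻¹) * qfac q (b * x) * qfac q (b * x⁻¹) *
      qfac q (c * x) * qfac q (c * x⁻¹) * qfac q (d * x) * qfac q (d * x⁻¹))

/-- The bilinear form `(f, g) = (2πi)⁻¹ ∫_C f(x) g(x⁻¹) Δ₊(x) dx/x`. -/
def form (q a b c d : ℂ) (C : JordanCurve) (f g : ℂ → ℂ) : ℂ :=
  1 / (2 * π * Complex.I) * C.integral (fun x => f x * g x⁻¹ * weight q a b c d x / x)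

end

end AskeyWilson

/-! Write `I(a,b,c,d)` for the integral of `Δ₊(x) dx/x` over the curve. The proof derives a
`q`-difference equation in each parameter, uses it to send all parameters to `0`, and evaluates what
remains.

Let `G(x) = Δ₊(x) ∏ (1 - e x) / (x (1 - x²))`, the product over the four parameters
(`raisedWeight`). It is odd under `x ↦ q⁻¹/x`, a map that exchanges its singularities inside and
outside the curve, so the integral of `G(x) dx/x` vanishes. So does that of `G(1/x) dx/x`, by the
same argument with `x ↦ 1/x`. Now `G(x) + G(1/x)` is a Laurent polynomial times `Δ₊`, and this
yields `(1 - abcd) I(aq,b,c,d) = (1 - ab)(1 - ac)(1 - ad) I(a,b,c,d)` (`integral_weight_mul_base`).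
Iterating, with `a qⁿ → 0`, and treating the other parameters alike gives
`qfac_mul_integral_weight_zero`.

Without parameters the curve can be replaced by the unit circle. The choice `0, 0, √q, -√q` shows
that `(q;q)_∞ I(0,0,0,0)` is unchanged under `q ↦ q²`; as `q^(2^m) → 0` the integrand becomes `(1 -
x²)(1 - x⁻²)/x`, whose residue at `0` is `2` (`integral_weight_zero_mul_qfac`).

Cauchy's theorem on a Lipschitz curve is obtained by approximation. The integrands are uniform
limits of rational functions, partial fractions reduce these to powers `(z - p)^n`, and only `n =
-1` contributes, through winding numbers (`integral_add_mul_integral_eq_zero`). -/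

open Filter Topology

namespace AskeyWilson

/-! ### Identities for infinite `q`-shifted factorials. -/

section QFactorial

variable {q : ℂ}

lemma summable_norm_mul_pow (hq : ‖q‖ < 1) (z : ℂ) : Summable fun k : ℕ => ‖-(z * q ^ k)‖ := by
  simp only [norm_neg, norm_mul, norm_pow]
  exact (summable_geometric_of_lt_one (norm_nonneg _) hq).mul_left _

lemma multipliable_one_sub_mul_pow (hq : ‖q‖ < 1) (z : ℂ) :
    Multipliable fun k : ℕ => 1 - z * q ^ k := by
  simpa only [sub_eq_add_neg] using multipliable_one_add_of_summable (summable_norm_mul_pow hq z)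

lemma tendsto_qfac (hq : ‖q‖ < 1) (z : ℂ) :
    Tendsto (fun n => ∏ k ∈ Finset.range n, (1 - z * q ^ k)) atTop (𝓝 (qfac q z)) :=
  (multipliable_one_sub_mul_pow hq z).tendsto_prod_tprod_nat

lemma qfac_eq_mul (hq : ‖q‖ < 1) (z : ℂ) : qfac q z = (1 - z) * qfac q (z * q) := by
  have e : ∀ k : ℕ, 1 - z * q * q ^ k = 1 - z * q ^ (k + 1) := fun k => by ring
  have h : Multipliable fun k : ℕ => 1 - z * q ^ (k + 1) := by
    simpa only [e] using multipliable_one_sub_mul_pow hq (z * q)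
  have h1 := tprod_eq_zero_mul' (f := fun k : ℕ => 1 - z * q ^ k) h
  simp only [qfac, e]
  rw [h1, pow_zero, mul_one]

lemma qfac_ne_zero (hq : ‖q‖ < 1) {z : ℂ} (h : ∀ k : ℕ, z * q ^ k ≠ 1) : qfac q z ≠ 0 := by
  have := tprod_one_add_ne_zero_of_summable (f := fun k : ℕ => -(z * q ^ k))
    (fun k => by rw [← sub_eq_add_neg]; exact sub_ne_zero.2 (h k).symm) (summable_norm_mul_pow hq z)
  simpa only [qfac, sub_eq_add_neg] using this

@[simp] lemma qfac_zero_right : qfac q 0 = 1 := by simp [qfac]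

/-- `(z; q)_∞ (-z; q)_∞ = (z²; q²)_∞`. -/
lemma qfac_mul_qfac_neg (hq : ‖q‖ < 1) (z : ℂ) :
    qfac q z * qfac q (-z) = qfac (q ^ 2) (z ^ 2) := by
  rw [qfac, qfac, ← (multipliable_one_sub_mul_pow hq z).tprod_mul
    (multipliable_one_sub_mul_pow hq (-z)), qfac]
  exact tprod_congr fun k => by ring

/-- `(z; q)_∞ = (z, qz; q²)_∞`. -/
lemma qfac_eq_mul_sq (hq : ‖q‖ < 1) (z : ℂ) :
    qfac q z = qfac (q ^ 2) z * qfac (q ^ 2) (z * q) := by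
  have hq2 : ‖q ^ 2‖ < 1 := by
    rw [norm_pow]; exact pow_lt_one₀ (norm_nonneg _) hq two_ne_zero
  have e : ∀ k : ℕ, 1 - z * q ^ (2 * k) = 1 - z * (q ^ 2) ^ k := fun k => by rw [pow_mul]
  have o : ∀ k : ℕ, 1 - z * q ^ (2 * k + 1) = 1 - z * q * (q ^ 2) ^ k := fun k => by
    rw [pow_succ, pow_mul]; ring
  rw [qfac, ← tprod_even_mul_odd]
  · simp only [e, o]; rfl
  · simp only [e]; exact multipliable_one_sub_mul_pow hq2 z
  · simp only [o]; exact multipliable_one_sub_mul_pow hq2 (z * q)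

end QFactorial

/-! ### Infinite products in the Banach algebra of continuous functions. -/

section ContinuousMap

variable {T : Type*} [TopologicalSpace T] [CompactSpace T]

lemma normOneClass_continuousMap [Nonempty T] : NormOneClass C(T, ℂ) :=
  ⟨by
    refine le_antisymm ((ContinuousMap.norm_le _ zero_le_one).2 fun t => by simp) ?_
    obtain ⟨t⟩ := ‹Nonempty T›
    exact le_of_eq_of_le (by simp) ((1 : C(T, ℂ)).norm_coe_le_norm t)⟩

lemma tprod_continuousMap_apply [Nonempty T] {f : ℕ → C(T, ℂ)} (hf : Summable fun k => ‖f k‖)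
    (t : T) : (∏' k, (1 + f k)) t = ∏' k, (1 + f k t) := by
  have := normOneClass_continuousMap (T := T)
  have := (multipliable_one_add_of_summable hf).map_tprod
    (ContinuousMap.evalAlgHom ℂ ℂ t) (continuous_eval_const t)
  simpa using this

/-- The partial products of `(u; q)_∞` converge uniformly, for a continuous function `u`. -/
lemma exists_tendsto_qfac {q : ℂ} (hq : ‖q‖ < 1) (u : C(T, ℂ)) :
    ∃ F : C(T, ℂ), (∀ t, F t = qfac q (u t)) ∧
      Tendsto (fun n => ∏ k ∈ Finset.range n, (1 - q ^ k • u)) atTop (𝓝 F) := by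
  rcases isEmpty_or_nonempty T with h | h
  · exact ⟨0, fun t => (h.false t).elim, tendsto_const_nhds.congr fun _ => by
      ext t; exact (h.false t).elim⟩
  have := normOneClass_continuousMap (T := T)
  have hs : Summable fun k : ℕ => ‖-(q ^ k • u)‖ := by
    simp only [norm_neg, norm_smul, norm_pow]
    exact (summable_geometric_of_lt_one (norm_nonneg _) hq).mul_right _
  refine ⟨∏' k : ℕ, (1 + -(q ^ k • u)), fun t => ?_, ?_⟩
  · rw [tprod_continuousMap_apply hs, qfac]
    exact tprod_congr fun k => by
      simp only [ContinuousMap.neg_apply, ContinuousMap.smul_apply, smul_eq_mul]; ring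
  · simpa only [sub_eq_add_neg] using
      (multipliable_one_add_of_summable hs).tendsto_prod_tprod_nat

end ContinuousMap

/-! ### Uniform limits of rational functions with prescribed poles. -/

section RationalLimit

variable {K P : Set ℂ} [CompactSpace K]

/-- The closure, for uniform convergence on the compact set `K`, of the algebra generated by the
functions `z - p` and `(z - p)⁻¹` with `p ∈ P`. -/
noncomputable def rationalClosure (K P : Set ℂ) [CompactSpace K] : Subalgebra ℂ C(K, ℂ) :=
  (Algebra.adjoin ℂ {F : C(K, ℂ) | ∃ p ∈ P, (∀ z : K, F z = z - p) ∨
    ∀ z : K, F z = ((z : ℂ) - p)⁻¹}).topologicalClosure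

/-- `g` is on `K` a uniform limit of rational functions with poles in `P`. -/
def IsRationalLimit (K P : Set ℂ) [CompactSpace K] (g : ℂ → ℂ) : Prop :=
  ∃ F ∈ rationalClosure K P, ∀ z : K, F z = g z

namespace IsRationalLimit

variable {f g : ℂ → ℂ}

lemma congr (hf : IsRationalLimit K P f) (h : ∀ z ∈ K, f z = g z) : IsRationalLimit K P g := by
  obtain ⟨F, hF, hFf⟩ := hf
  exact ⟨F, hF, fun z => (hFf z).trans (h z z.2)⟩

lemma mul (hf : IsRationalLimit K P f) (hg : IsRationalLimit K P g) :
    IsRationalLimit K P (fun z => f z * g z) := by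
  obtain ⟨F, hF, hFf⟩ := hf
  obtain ⟨G, hG, hGg⟩ := hg
  exact ⟨F * G, mul_mem hF hG, fun z => by simp [hFf, hGg]⟩

lemma const (c : ℂ) : IsRationalLimit K P (fun _ => c) :=
  ⟨algebraMap ℂ _ c, Subalgebra.algebraMap_mem _ c, fun z => by simp⟩

lemma pow (hf : IsRationalLimit K P f) (n : ℕ) : IsRationalLimit K P (fun z => f z ^ n) := by
  obtain ⟨F, hF, hFf⟩ := hf
  exact ⟨F ^ n, pow_mem hF n, fun z => by simp [hFf]⟩

lemma id (h0 : (0 : ℂ) ∈ P) : IsRationalLimit K P (fun z => z) :=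
  ⟨⟨fun z => z, by fun_prop⟩, Subalgebra.le_topologicalClosure _
    (Algebra.subset_adjoin ⟨0, h0, Or.inl fun z => by simp⟩), fun z => rfl⟩

lemma inv_sub (hK : ∀ p ∈ P, p ∉ K) {p : ℂ} (hp : p ∈ P) :
    IsRationalLimit K P (fun z => (z - p)⁻¹) := by
  have h : ∀ z : K, (z : ℂ) - p ≠ 0 := fun z hz => hK p hp (sub_eq_zero.1 hz ▸ z.2)
  exact ⟨⟨fun z => ((z : ℂ) - p)⁻¹, by fun_prop (disch := exact h _)⟩,
    Subalgebra.le_topologicalClosure _ (Algebra.subset_adjoin ⟨p, hp, Or.inr fun z => rfl⟩),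
    fun z => rfl⟩

lemma inv (hK : ∀ p ∈ P, p ∉ K) (h0 : (0 : ℂ) ∈ P) : IsRationalLimit K P (fun z => z⁻¹) := by
  simpa using inv_sub hK h0

lemma qfac {q : ℂ} (hq : ‖q‖ < 1) (hf : IsRationalLimit K P f) :
    IsRationalLimit K P (fun z => qfac q (f z)) := by
  obtain ⟨F, hF, hFf⟩ := hf
  obtain ⟨G, hG, hlim⟩ := exists_tendsto_qfac hq F
  refine ⟨G, ?_, fun z => by rw [hG, hFf]⟩
  exact (Subalgebra.isClosed_topologicalClosure _).mem_of_tendsto hlim <| Eventually.of_forall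
    fun n => prod_mem fun k _ => sub_mem (one_mem _) (Subalgebra.smul_mem _ hF _)

/-- The limit of the partial products has no zero on `K`, hence is a unit of `C(K, ℂ)`. Inversion is
continuous at units, so the reciprocals of the partial products converge uniformly as well. -/
lemma qfac_inv {q : ℂ} (hq : ‖q‖ < 1) (hf : IsRationalLimit K P f)
    (hne : ∀ z ∈ K, ∀ k : ℕ, f z * q ^ k ≠ 1)
    (hinv : ∀ k : ℕ, IsRationalLimit K P (fun z => (1 - f z * q ^ k)⁻¹)) :
    IsRationalLimit K P (fun z => (AskeyWilson.qfac q (f z))⁻¹) := by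
  obtain ⟨F, hF, hFf⟩ := hf
  obtain ⟨G, hG, hlim⟩ := exists_tendsto_qfac hq F
  choose H hH hHf using hinv
  have hG0 : ∀ z : K, G z ≠ 0 := fun z => by
    rw [hG, hFf]; exact qfac_ne_zero hq (hne z z.2)
  obtain ⟨U, hU⟩ := (ContinuousMap.isUnit_iff_forall_ne_zero G).2 hG0
  have hUz : ∀ z : K, (↑U⁻¹ : C(K, ℂ)) z = (G z)⁻¹ := fun z => by
    refine eq_inv_of_mul_eq_one_right ?_
    rw [← hU, ← ContinuousMap.mul_apply, Units.mul_inv, ContinuousMap.one_apply]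
  refine ⟨↑U⁻¹, ?_, fun z => by rw [hUz, hG, hFf]⟩
  have h1 : Tendsto (fun n => (∏ k ∈ Finset.range n, H k)) atTop (𝓝 (↑U⁻¹ : C(K, ℂ))) := by
    have h2 := (NormedRing.inverse_continuousAt U).tendsto.comp (hU ▸ hlim)
    rw [Ring.inverse_unit] at h2
    refine h2.congr fun n => ?_
    have : (∏ k ∈ Finset.range n, (1 - q ^ k • F)) * (∏ k ∈ Finset.range n, H k) = 1 := by
      rw [← Finset.prod_mul_distrib]
      refine Finset.prod_eq_one fun k _ => ?_
      ext z
      simp only [ContinuousMap.mul_apply, ContinuousMap.sub_apply, ContinuousMap.one_apply,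
        ContinuousMap.smul_apply, hFf, hHf, smul_eq_mul]
      rw [mul_comm (q ^ k)]
      exact mul_inv_cancel₀ (sub_ne_zero.2 (hne z z.2 k).symm)
    exact Ring.inverse_unit (Units.mkOfMulEqOne _ _ this)
  exact (Subalgebra.isClosed_topologicalClosure _).mem_of_tendsto h1 <| Eventually.of_forall
    fun n => prod_mem fun k _ => hH k

end IsRationalLimit

/-- A continuous functional that annihilates all `(z - p)^n`, for `p ∈ P` and `n ∈ ℤ`, annihilates
all uniform limits of rational functions with poles in `P`. -/
lemma apply_eq_zero_of_mem_rationalClosure (hK : ∀ p ∈ P, p ∉ K) (hP : P.Nonempty)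
    (Φ : C(K, ℂ) →L[ℂ] ℂ)
    (hΦ : ∀ p ∈ P, ∀ n : ℤ, ∀ F : C(K, ℂ), (∀ z : K, F z = ((z : ℂ) - p) ^ n) → Φ F = 0)
    {F : C(K, ℂ)} (hF : F ∈ rationalClosure K P) : Φ F = 0 := by
  let B : Set C(K, ℂ) := {F | ∃ p ∈ P, ∃ n : ℤ, ∀ z : K, F z = ((z : ℂ) - p) ^ n}
  let V := Submodule.span ℂ B
  have hne : ∀ p ∈ P, ∀ z : K, (z : ℂ) - p ≠ 0 := fun p hp z hz =>
    hK p hp (sub_eq_zero.1 hz ▸ z.2)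
  have hpow : ∀ p ∈ P, ∀ n : ℤ, ∃ E : C(K, ℂ), ∀ z : K, E z = ((z : ℂ) - p) ^ n :=
    fun p hp n => ⟨⟨fun z => ((z : ℂ) - p) ^ n, (by
      fun_prop : Continuous fun z : K => (z : ℂ) - p).zpow₀ n fun z => Or.inl (hne p hp z)⟩,
      fun z => rfl⟩
  choose! E hE using hpow
  have hEV : ∀ p ∈ P, ∀ n, E p n ∈ V := fun p hp n => Submodule.subset_span ⟨p, hp, n, hE p hp n⟩
  have hgen : ∀ p ∈ P, ∀ G : C(K, ℂ), ((∀ z : K, G z = z - p) ∨ ∀ z : K, G z = ((z : ℂ) - p)⁻¹) →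
      ∀ r ∈ P, ∀ n, G * E r n ∈ V := by
    rintro p hp G (hG | hG) r hr n
    · have : G * E r n = E r (n + 1) + (r - p) • E r n := by
        ext z
        simp only [ContinuousMap.mul_apply, ContinuousMap.add_apply, ContinuousMap.smul_apply,
          smul_eq_mul, hG, hE r hr, zpow_add_one₀ (hne r hr z)]
        ring
      rw [this]
      exact add_mem (hEV r hr _) (Submodule.smul_mem _ _ (hEV r hr _))
    · by_cases hpr : p = r
      · subst hpr
        have : G * E p n = E p (n - 1) := by
          ext z
          simp only [ContinuousMap.mul_apply, hG, hE p hp, zpow_sub_one₀ (hne p hp z)]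
          ring
        rw [this]
        exact hEV p hp _
      -- Partial fractions, from `(z - r)/(z - p) = 1 + (p - r)/(z - p)`. Since `p ≠ r`, the
      -- recursion can be run from `n = 0` in both directions.
      · have hstep : ∀ m, G * E r (m + 1) = E r m + (p - r) • (G * E r m) := fun m => by
          ext z
          simp only [ContinuousMap.mul_apply, ContinuousMap.add_apply, ContinuousMap.smul_apply,
            smul_eq_mul, hG, hE r hr, zpow_add_one₀ (hne r hr z)]
          have := hne p hp z
          field_simp
          ring
        have hpr' : p - r ≠ 0 := sub_ne_zero.2 hpr
        induction n with
        | zero =>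
          have : G * E r 0 = E p (-1) := by
            ext z
            simp [hG, hE r hr, hE p hp]
          rw [this]
          exact hEV p hp _
        | succ m ih =>
          rw [hstep]
          exact add_mem (hEV r hr _) (Submodule.smul_mem _ _ ih)
        | pred m ih =>
          have h := hstep (-(m : ℤ) - 1)
          rw [sub_add_cancel] at h
          have h' : G * E r (-(m : ℤ) - 1)
              = (p - r)⁻¹ • (G * E r (-(m : ℤ)) - E r (-(m : ℤ) - 1)) := by
            rw [h, add_sub_cancel_left, smul_smul, inv_mul_cancel₀ hpr', one_smul]
          rw [h']
          exact Submodule.smul_mem _ _ (sub_mem ih (hEV r hr _))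
  -- The span of the powers is stable under the generators, hence under the algebra; as it contains
  -- `1`, it contains the algebra.
  have hmulV : ∀ G ∈ Algebra.adjoin ℂ {F : C(K, ℂ) | ∃ p ∈ P, (∀ z : K, F z = z - p) ∨
      ∀ z : K, F z = ((z : ℂ) - p)⁻¹}, ∀ v ∈ V, G * v ∈ V := by
    intro G hG
    induction hG using Algebra.adjoin_induction with
    | mem G hG =>
      obtain ⟨p, hp, hG⟩ := hG
      intro v hv
      induction hv using Submodule.span_induction with
      | mem v hv =>
        obtain ⟨r, hr, n, hv⟩ := hv
        have : v = E r n := by ext z; rw [hv, hE r hr]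
        rw [this]
        exact hgen p hp G hG r hr n
      | zero => simp
      | add x y _ _ hx hy => rw [mul_add]; exact add_mem hx hy
      | smul c x _ hx => rw [mul_smul_comm]; exact Submodule.smul_mem _ _ hx
    | algebraMap c => intro v hv; rw [← Algebra.smul_def]; exact Submodule.smul_mem _ _ hv
    | add x y _ _ hx hy => intro v hv; rw [add_mul]; exact add_mem (hx v hv) (hy v hv)
    | mul x y _ _ hx hy => intro v hv; rw [mul_assoc]; exact hx _ (hy v hv)
  have hVker : ∀ v ∈ V, Φ v = 0 := fun v hv => by
    induction hv using Submodule.span_induction with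
    | mem v hv => obtain ⟨p, hp, n, hv⟩ := hv; exact hΦ p hp n v hv
    | zero => simp
    | add x y _ _ hx hy => rw [map_add, hx, hy, add_zero]
    | smul c x _ hx => rw [map_smul, hx, smul_zero]
  obtain ⟨p, hp⟩ := hP
  have h1 : (1 : C(K, ℂ)) ∈ V := by
    have : (1 : C(K, ℂ)) = E p 0 := by ext z; simp [hE p hp]
    rw [this]; exact hEV p hp 0
  have hclosed : IsClosed {F : C(K, ℂ) | Φ F = 0} := isClosed_eq Φ.continuous continuous_const
  refine closure_minimal (fun G hG => ?_) hclosed hF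
  exact hVker G (by simpa using hmulV G hG 1 h1)

end RationalLimit

open MeasureTheory Set

/-! ### The fundamental theorem of calculus for absolutely continuous complex functions. -/

section FundamentalTheorem

lemma absolutelyContinuousOnInterval_comp_lipschitz {X Y : Type*} [PseudoMetricSpace X]
    [PseudoMetricSpace Y] {f : ℝ → X} {a b : ℝ} (hf : AbsolutelyContinuousOnInterval f a b)
    {g : X → Y} (hg : LipschitzWith 1 g) : AbsolutelyContinuousOnInterval (g ∘ f) a b := by
  rw [absolutelyContinuousOnInterval_iff] at hf ⊢
  intro ε hε
  obtain ⟨δ, hδ, h⟩ := hf ε hε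
  refine ⟨δ, hδ, fun E hE hE' => lt_of_le_of_lt (Finset.sum_le_sum fun i _ => ?_) (h E hE hE')⟩
  simpa using hg.dist_le_mul (f (E.2 i).1) (f (E.2 i).2)

lemma integral_eq_sub_of_absolutelyContinuous {f f' : ℝ → ℂ} {a b : ℝ}
    (hf : AbsolutelyContinuousOnInterval f a b)
    (hf' : ∀ᵐ t, t ∈ uIoc a b → HasDerivAt f (f' t) t) (hint : IntervalIntegrable f' volume a b) :
    ∫ t in a..b, f' t = f b - f a := by
  have hre : ∀ᵐ t, t ∈ uIoc a b → deriv (Complex.reCLM ∘ f) t = Complex.reCLM (f' t) :=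
    hf'.mono fun t ht h => (Complex.reCLM.hasFDerivAt.comp_hasDerivAt t (ht h)).deriv
  have him : ∀ᵐ t, t ∈ uIoc a b → deriv (Complex.imCLM ∘ f) t = Complex.imCLM (f' t) :=
    hf'.mono fun t ht h => (Complex.imCLM.hasFDerivAt.comp_hasDerivAt t (ht h)).deriv
  have hLre : LipschitzWith 1 Complex.reCLM := LipschitzWith.of_dist_le_mul fun x y => by
    simpa [Complex.dist_eq, Real.dist_eq] using Complex.abs_re_le_norm (x - y)
  have hLim : LipschitzWith 1 Complex.imCLM := LipschitzWith.of_dist_le_mul fun x y => by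
    simpa [Complex.dist_eq, Real.dist_eq] using Complex.abs_im_le_norm (x - y)
  have h1 := (absolutelyContinuousOnInterval_comp_lipschitz hf hLre).integral_deriv_eq_sub
  have h2 := (absolutelyContinuousOnInterval_comp_lipschitz hf hLim).integral_deriv_eq_sub
  rw [intervalIntegral.integral_congr_ae hre,
    Complex.reCLM.intervalIntegral_comp_comm hint] at h1
  rw [intervalIntegral.integral_congr_ae him,
    Complex.imCLM.intervalIntegral_comp_comm hint] at h2
  apply Complex.ext
  · simpa using h1
  · simpa using h2

end FundamentalTheorem

/-! ### Contour integrals and winding numbers. -/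

namespace JordanCurve

variable (C : JordanCurve)

lemma continuousOn_param : ContinuousOn C.param (Icc 0 1) := C.lipschitz.choose_spec.continuousOn

lemma isCompact_trace : IsCompact C.trace := isCompact_Icc.image_of_continuousOn C.continuousOn_param

lemma param_mem_trace {t : ℝ} (ht : t ∈ Icc (0 : ℝ) 1) : C.param t ∈ C.trace := ⟨t, ht, rfl⟩

lemma ae_ne_one : ∀ᵐ t : ℝ, t ≠ 1 := by simp [ae_iff, measure_singleton]

lemma ae_hasDerivAt : ∀ᵐ t : ℝ, t ∈ uIoc (0 : ℝ) 1 →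
    HasDerivAt C.param (deriv C.param t) t := by
  obtain ⟨k, hk⟩ := C.lipschitz
  -- `param` is arbitrary outside `[0, 1]`, so differentiability within the interval gives a
  -- derivative only at interior points; the endpoint `1` is a null set.
  filter_upwards [hk.ae_differentiableWithinAt_of_mem (μ := volume), ae_ne_one] with t ht h1 hmem
  rw [uIoc_of_le zero_le_one] at hmem
  exact ((ht ⟨hmem.1.le, hmem.2⟩).differentiableAt
    (Icc_mem_nhds hmem.1 (lt_of_le_of_ne hmem.2 h1))).hasDerivAt

lemma exists_norm_deriv_le : ∃ k : ℝ, 0 ≤ k ∧ ∀ t ∈ Ioo (0 : ℝ) 1, ‖deriv C.param t‖ ≤ k := by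
  obtain ⟨k, hk⟩ := C.lipschitz
  exact ⟨k, k.2, fun t ht => norm_deriv_le_of_lipschitzOn (Icc_mem_nhds ht.1 ht.2) hk⟩

lemma intervalIntegrable_deriv : IntervalIntegrable (deriv C.param) volume 0 1 := by
  obtain ⟨k, -, hk⟩ := C.exists_norm_deriv_le
  rw [intervalIntegrable_iff_integrableOn_Ioo_of_le zero_le_one]
  exact Measure.integrableOn_of_bounded (M := k) (by simp) (measurable_deriv _).aestronglyMeasurable
    ((ae_restrict_iff' measurableSet_Ioo).2 (Eventually.of_forall hk))

lemma intervalIntegrable_mul_deriv {f : ℂ → ℂ} (hf : ContinuousOn f C.trace) :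
    IntervalIntegrable (fun t => f (C.param t) * deriv C.param t) volume 0 1 :=
  C.intervalIntegrable_deriv.continuousOn_mul <| by
    rw [uIcc_of_le zero_le_one]
    exact hf.comp C.continuousOn_param fun t ht => C.param_mem_trace ht

variable {C} in
lemma integral_congr {f g : ℂ → ℂ} (h : ∀ z ∈ C.trace, f z = g z) : C.integral f = C.integral g :=
  intervalIntegral.integral_congr fun t ht => by
    rw [uIcc_of_le zero_le_one] at ht
    simp only [h _ (C.param_mem_trace ht)]

lemma integral_const_mul (c : ℂ) (f : ℂ → ℂ) :
    C.integral (fun x => c * f x) = c * C.integral f := by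
  simp only [integral, mul_assoc, intervalIntegral.integral_const_mul]

lemma integral_neg (f : ℂ → ℂ) : C.integral (fun x => -f x) = -C.integral f := by
  simp only [integral, neg_mul, intervalIntegral.integral_neg]

lemma integral_add {f g : ℂ → ℂ} (hf : ContinuousOn f C.trace) (hg : ContinuousOn g C.trace) :
    C.integral (fun x => f x + g x) = C.integral f + C.integral g := by
  simp only [integral, add_mul]
  exact intervalIntegral.integral_add (C.intervalIntegrable_mul_deriv hf)
    (C.intervalIntegrable_mul_deriv hg)

lemma integral_sub {f g : ℂ → ℂ} (hf : ContinuousOn f C.trace) (hg : ContinuousOn g C.trace) :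
    C.integral (fun x => f x - g x) = C.integral f - C.integral g := by
  simp only [integral, sub_mul]
  exact intervalIntegral.integral_sub (C.intervalIntegrable_mul_deriv hf)
    (C.intervalIntegrable_mul_deriv hg)

lemma exists_norm_integral_le : ∃ k : ℝ, 0 ≤ k ∧ ∀ (f : ℂ → ℂ) (M : ℝ),
    (∀ z ∈ C.trace, ‖f z‖ ≤ M) → ‖C.integral f‖ ≤ k * M := by
  obtain ⟨k, hk0, hk⟩ := C.exists_norm_deriv_le
  refine ⟨k, hk0, fun f M hM => ?_⟩
  have := intervalIntegral.norm_integral_le_of_norm_le_const_ae (a := 0) (b := 1) (C := k * M)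
    (f := fun t => f (C.param t) * deriv C.param t) ?_
  · simpa [integral] using this
  · filter_upwards [ae_ne_one] with t h1 ht
    rw [uIoc_of_le zero_le_one] at ht
    rw [norm_mul, mul_comm]
    exact mul_le_mul (hk t ⟨ht.1, lt_of_le_of_ne ht.2 h1⟩)
      (hM _ (C.param_mem_trace ⟨ht.1.le, ht.2⟩)) (norm_nonneg _) hk0

/-- Integration along the curve as a continuous functional on `C(K, ℂ)`, for a set `K` that
contains the curve. -/
lemma exists_integral_continuousLinearMap {K : Set ℂ} [CompactSpace K] (hK : C.trace ⊆ K) :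
    ∃ Φ : C(K, ℂ) →L[ℂ] ℂ, ∀ (F : C(K, ℂ)) (f : ℂ → ℂ), (∀ z : K, F z = f z) →
      Φ F = C.integral f := by
  classical
  -- The value `0` off `K` is immaterial, because the curve lies in `K`.
  let ext : C(K, ℂ) → ℂ → ℂ := fun F z => if h : z ∈ K then F ⟨z, h⟩ else 0
  have hext : ∀ (F : C(K, ℂ)) (z : K), ext F z = F z := fun F z => by simp [ext]
  have hcont : ∀ F, ContinuousOn (ext F) C.trace := fun F => by
    refine ContinuousOn.mono ?_ hK
    rw [continuousOn_iff_continuous_domRestrict]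
    exact F.continuous.congr fun z => (hext F z).symm
  obtain ⟨k, -, hk⟩ := C.exists_norm_integral_le
  refine ⟨LinearMap.mkContinuous
    { toFun := fun F => C.integral (ext F)
      map_add' := fun F G => by
        rw [← C.integral_add (hcont F) (hcont G)]
        exact integral_congr fun z hz => by
          rw [hext _ ⟨z, hK hz⟩, hext _ ⟨z, hK hz⟩, hext _ ⟨z, hK hz⟩, ContinuousMap.add_apply]
      map_smul' := fun c F => by
        rw [RingHom.id_apply, smul_eq_mul, ← C.integral_const_mul]
        exact integral_congr fun z hz => by
          rw [hext _ ⟨z, hK hz⟩, hext _ ⟨z, hK hz⟩, ContinuousMap.smul_apply, smul_eq_mul] }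
    k fun F => hk _ _ fun z hz => by
      rw [hext _ ⟨z, hK hz⟩]; exact F.norm_coe_le_norm _, fun F f h => ?_⟩
  exact integral_congr fun z hz => by rw [hext _ ⟨z, hK hz⟩, h]

lemma exists_pos_le_norm_sub {p : ℂ} (hp : p ∉ C.trace) :
    ∃ δ > 0, ∀ z ∈ C.trace, δ ≤ ‖z - p‖ := by
  obtain ⟨δ, hδ, h⟩ := Metric.isOpen_iff.1 C.isCompact_trace.isClosed.isOpen_compl p hp
  refine ⟨δ, hδ, fun z hz => ?_⟩
  by_contra! hlt
  exact h (by rwa [Metric.mem_ball, dist_eq_norm]) hz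

lemma lipschitzOnWith_inv {p : ℂ} (hp : p ∉ C.trace) :
    ∃ k : NNReal, LipschitzOnWith k (fun t => (C.param t - p)⁻¹) (Icc 0 1) := by
  obtain ⟨k, hk⟩ := C.lipschitz
  obtain ⟨δ, hδ, h⟩ := C.exists_pos_le_norm_sub hp
  refine ⟨k / (δ ^ 2).toNNReal, LipschitzOnWith.of_dist_le_mul fun s hs t ht => ?_⟩
  have h1 := h _ (C.param_mem_trace hs)
  have h2 := h _ (C.param_mem_trace ht)
  have n1 : C.param s - p ≠ 0 := norm_pos_iff.1 (hδ.trans_le h1)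
  have n2 : C.param t - p ≠ 0 := norm_pos_iff.1 (hδ.trans_le h2)
  have hd := hk.dist_le_mul s hs t ht
  rw [dist_eq_norm] at hd ⊢
  rw [inv_sub_inv n1 n2, norm_div, norm_mul, sub_sub_sub_cancel_right, norm_sub_rev]
  rw [NNReal.coe_div, Real.coe_toNNReal _ (by positivity), div_mul_eq_mul_div]
  refine div_le_div₀ (by positivity) hd (by positivity) ?_
  rw [sq]
  exact mul_le_mul h1 h2 hδ.le (norm_nonneg _)

lemma absolutelyContinuous_zpow {p : ℂ} (hp : p ∉ C.trace) (n : ℤ) :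
    AbsolutelyContinuousOnInterval (fun t => (C.param t - p) ^ n) 0 1 := by
  have key : ∀ u : ℝ → ℂ, AbsolutelyContinuousOnInterval u 0 1 →
      ∀ n : ℕ, AbsolutelyContinuousOnInterval (fun t => u t ^ n) 0 1 := fun u hu n => by
    induction n with
    | zero =>
      simp only [pow_zero]
      exact ((LipschitzWith.const' (K := 0) (1 : ℂ)).lipschitzOnWith).absolutelyContinuousOnInterval
    | succ n ih => simpa only [pow_succ] using! ih.smul hu
  have hI : uIcc (0 : ℝ) 1 = Icc 0 1 := uIcc_of_le zero_le_one
  cases n with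
  | ofNat n =>
    obtain ⟨k, hk⟩ := C.lipschitz
    have : LipschitzOnWith k (fun t => C.param t - p) (uIcc 0 1) := by
      rw [hI]
      exact LipschitzOnWith.of_dist_le_mul fun s hs t ht => by
        simpa using hk.dist_le_mul s hs t ht
    simpa using key _ this.absolutelyContinuousOnInterval n
  | negSucc n =>
    obtain ⟨k, hk⟩ := C.lipschitzOnWith_inv hp
    rw [← hI] at hk
    simpa [zpow_negSucc] using key _ hk.absolutelyContinuousOnInterval (n + 1)

lemma continuousOn_zpow {p : ℂ} (hp : p ∉ C.trace) (n : ℤ) :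
    ContinuousOn (fun z => (z - p) ^ n) C.trace :=
  ContinuousOn.zpow₀ (by fun_prop) n fun z hz => Or.inl fun h => hp (sub_eq_zero.1 h ▸ hz)

/-- `(z - p)^(n+1)/(n+1)` is a primitive, absolutely continuous along the curve, and the curve is
closed. -/
lemma integral_zpow {p : ℂ} (hp : p ∉ C.trace) {n : ℤ} (hn : n ≠ -1) :
    C.integral (fun z => (z - p) ^ n) = 0 := by
  have hn' : ((n + 1 : ℤ) : ℂ) ≠ 0 := by
    rw [Int.cast_ne_zero]; omega
  have h := integral_eq_sub_of_absolutelyContinuous (C.absolutelyContinuous_zpow hp (n + 1))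
    (f' := fun t => ((n + 1 : ℤ) : ℂ) * ((C.param t - p) ^ n * deriv C.param t)) ?_
    ((C.intervalIntegrable_mul_deriv (C.continuousOn_zpow hp n)).const_mul _)
  · rw [C.closed, sub_self, intervalIntegral.integral_const_mul] at h
    exact (mul_eq_zero.1 h).resolve_left hn'
  · filter_upwards [C.ae_hasDerivAt] with t ht hmem
    have hne : C.param t - p ≠ 0 := fun h0 => hp <| by
      rw [uIoc_of_le zero_le_one] at hmem
      exact sub_eq_zero.1 h0 ▸ C.param_mem_trace ⟨hmem.1.le, hmem.2⟩
    have := (hasDerivAt_zpow (n + 1) (C.param t - p) (Or.inl hne)).comp t ((ht hmem).sub_const p)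
    rw [add_sub_cancel_right, mul_assoc] at this
    exact this

/-- The winding number of the curve around `p`. -/
noncomputable def winding (p : ℂ) : ℂ := 1 / (2 * π * Complex.I) * C.integral (fun x => 1 / (x - p))

lemma integral_inv_sub (p : ℂ) :
    C.integral (fun x => (x - p)⁻¹) = 2 * π * Complex.I * C.winding p := by
  have : (2 * π * Complex.I : ℂ) ≠ 0 := Complex.two_pi_I_ne_zero
  simp only [winding, one_div]
  rw [mul_inv_cancel_left₀ this]

/-- Differentiation under the integral sign, done as differentiation of the inverse in `C(C.trace,
ℂ)`: the derivative is the integral of `(z - p)⁻²`, which is zero. Winding numbers are thus locally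
constant. -/
lemma hasDerivAt_integral_inv_sub {p : ℂ} (hp : p ∉ C.trace) :
    HasDerivAt (fun p => C.integral fun x => (x - p)⁻¹) 0 p := by
  have : CompactSpace C.trace := isCompact_iff_compactSpace.1 C.isCompact_trace
  obtain ⟨Φ, hΦ⟩ := C.exists_integral_continuousLinearMap subset_rfl
  let X : C(C.trace, ℂ) := ⟨fun z => z, by fun_prop⟩
  have hunit : ∀ r ∉ C.trace, ∃ U : C(C.trace, ℂ)ˣ, (U : C(C.trace, ℂ)) = X - algebraMap ℂ _ r ∧
      ∀ z, (↑U⁻¹ : C(C.trace, ℂ)) z = ((z : ℂ) - r)⁻¹ := fun r hr => by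
    have h0 : ∀ z : C.trace, (X - algebraMap ℂ C(C.trace, ℂ) r) z ≠ 0 := fun z h =>
      hr <| by
        have : (z : ℂ) = r := by simpa [X, sub_eq_zero] using h
        exact this ▸ z.2
    obtain ⟨U, hU⟩ := (ContinuousMap.isUnit_iff_forall_ne_zero _).2 h0
    refine ⟨U, hU, fun z => eq_inv_of_mul_eq_one_right ?_⟩
    have := congrArg (fun F : C(C.trace, ℂ) => F z) (Units.mul_inv U)
    simpa [hU, X] using this
  obtain ⟨U, hU, hUz⟩ := hunit p hp
  have h1 : HasDerivAt (fun r : ℂ => X - algebraMap ℂ C(C.trace, ℂ) r) (-1) p := by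
    have : HasDerivAt (fun r : ℂ => algebraMap ℂ C(C.trace, ℂ) r) 1 p := by
      simp only [Algebra.algebraMap_eq_smul_one]
      simpa using (hasDerivAt_id p).smul_const (1 : C(C.trace, ℂ))
    exact this.const_sub X
  have h2 : HasFDerivAt (𝕜 := ℂ) Ring.inverse
      (-ContinuousLinearMap.mulLeftRight ℂ C(C.trace, ℂ) ↑U⁻¹ ↑U⁻¹)
      (X - algebraMap ℂ C(C.trace, ℂ) p) := hU ▸ hasFDerivAt_ringInverse U
  have h3 := Φ.hasFDerivAt.comp_hasDerivAt p (h2.comp_hasDerivAt p h1)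
  have h4 : Φ ((-ContinuousLinearMap.mulLeftRight ℂ C(C.trace, ℂ) ↑U⁻¹ ↑U⁻¹) (-1)) = 0 := by
    rw [hΦ _ (fun z => (z - p) ^ (-2 : ℤ)), C.integral_zpow hp (by norm_num)]
    intro z
    simp [ContinuousLinearMap.mulLeftRight_apply, hUz, zpow_neg, sq]
  rw [h4] at h3
  refine h3.congr_of_eventuallyEq ?_
  filter_upwards [C.isCompact_trace.isClosed.isOpen_compl.mem_nhds hp] with r hr
  obtain ⟨W, hW, hWz⟩ := hunit r hr
  simp only [Function.comp]
  rw [← hW, Ring.inverse_unit]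
  exact (hΦ _ _ hWz).symm

/-- The winding number is constant on the component of `p`, and that component contains points so
remote that the integral is arbitrarily small. -/
lemma winding_eq_zero {p : ℂ} (hp : p ∈ C.outside) : C.winding p = 0 := by
  obtain ⟨hp, hb⟩ := hp
  set S := connectedComponentIn C.traceᶜ p
  have hSsub : S ⊆ C.traceᶜ := connectedComponentIn_subset _ _
  have hSo : IsOpen S := C.isCompact_trace.isClosed.isOpen_compl.connectedComponentIn
  have hpS : p ∈ S := mem_connectedComponentIn hp
  obtain ⟨k, hk0, hk⟩ := C.exists_norm_integral_le
  obtain ⟨R, hR⟩ := C.isCompact_trace.isBounded.exists_norm_le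
  suffices h : C.integral (fun x => (x - p)⁻¹) = 0 by
    simp only [winding, one_div, h, mul_zero]
  rw [← norm_eq_zero]
  refine le_antisymm (le_of_forall_pos_le_add fun ε hε => ?_) (norm_nonneg _)
  -- Such an `r` has distance at least `k/ε + 1` from the curve, which bounds the integral by `k /
  -- (k/ε + 1) ≤ ε`.
  obtain ⟨r, hrS, hr⟩ : ∃ r ∈ S, R + (k / ε + 1) < ‖r‖ := by
    by_contra! h
    exact hb ((isBounded_iff_forall_norm_le).2 ⟨_, h⟩)
  have hconst := hSo.is_const_of_deriv_eq_zero isPreconnected_connectedComponentIn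
    (f := fun p => C.integral fun x => (x - p)⁻¹)
    (fun z hz => (C.hasDerivAt_integral_inv_sub (hSsub hz)).differentiableAt.differentiableWithinAt)
    (fun z hz => (C.hasDerivAt_integral_inv_sub (hSsub hz)).deriv) hpS hrS
  have hd : 0 < k / ε + 1 := by positivity
  rw [hconst, zero_add]
  refine (hk _ (k / ε + 1)⁻¹ fun z hz => ?_).trans ?_
  · rw [norm_inv]
    refine inv_anti₀ hd ?_
    have := norm_sub_norm_le r z
    rw [norm_sub_rev] at this
    linarith [hR z hz]
  · rw [← div_eq_mul_inv, div_le_iff₀ hd]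
    have : ε * (k / ε) = k := by field_simp
    nlinarith

end JordanCurve

/-! ### Cauchy's theorem and the substitution `x ↦ c / x`. -/

namespace JordanCurve

variable (C : JordanCurve)

/-- The image of a curve that avoids the origin under `x ↦ c / x`. -/
noncomputable def inversion {c : ℂ} (hc : c ≠ 0) (h0 : (0 : ℂ) ∉ C.trace) : JordanCurve where
  param t := c / C.param t
  lipschitz := by
    obtain ⟨k, hk⟩ := C.lipschitzOnWith_inv h0
    refine ⟨‖c‖₊ * k, LipschitzOnWith.of_dist_le_mul fun s hs t ht => ?_⟩
    have := hk.dist_le_mul s hs t ht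
    simp only [sub_zero, dist_eq_norm] at this
    rw [dist_eq_norm, div_eq_mul_inv, div_eq_mul_inv, ← mul_sub, norm_mul, NNReal.coe_mul,
      coe_nnnorm, mul_assoc]
    exact mul_le_mul_of_nonneg_left this (norm_nonneg _)
  closed := by rw [C.closed]
  simple := fun s hs t ht h => C.simple hs ht (by
    simp only [div_eq_mul_inv] at h
    exact inv_injective (mul_left_cancel₀ hc h))

variable {C} {c : ℂ} (hc : c ≠ 0) (h0 : (0 : ℂ) ∉ C.trace)

lemma trace_inversion : (C.inversion hc h0).trace = (fun x => c / x) '' C.trace := by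
  simp only [trace, image_image, inversion]

lemma mem_trace_inversion {p : ℂ} (hp : p ∈ (C.inversion hc h0).trace) : c / p ∈ C.trace := by
  rw [trace_inversion] at hp
  obtain ⟨x, hx, rfl⟩ := hp
  rwa [div_div_cancel₀ hc]

lemma zero_notMem_trace_inversion : (0 : ℂ) ∉ (C.inversion hc h0).trace := fun h => by
  have := mem_trace_inversion hc h0 h
  rw [div_zero] at this
  exact h0 this

lemma integral_inversion (f : ℂ → ℂ) :
    (C.inversion hc h0).integral f = -C.integral (fun x => f (c / x) * (c / x ^ 2)) := by
  rw [← integral_neg]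
  refine intervalIntegral.integral_congr_ae ?_
  filter_upwards [C.ae_hasDerivAt] with t ht hmem
  have hne : C.param t ≠ 0 := fun h => h0 <| by
    rw [uIoc_of_le zero_le_one] at hmem
    exact h ▸ C.param_mem_trace ⟨hmem.1.le, hmem.2⟩
  have := ((ht hmem).fun_inv hne).const_mul c
  simp only [inversion, div_eq_mul_inv] at this ⊢
  rw [this.deriv]
  ring

/-- The logarithmic differential of `c/x - p` is `dx/(x - c/p) - dx/x`. -/
lemma integral_inv_sub_inversion {p : ℂ} (hp0 : p ≠ 0) (hp : c / p ∉ C.trace) :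
    (C.inversion hc h0).integral (fun x => (x - p)⁻¹) =
      2 * π * Complex.I * (C.winding (c / p) - C.winding 0) := by
  rw [integral_inversion, mul_sub, ← integral_inv_sub, ← integral_inv_sub, ← integral_neg,
    ← C.integral_sub]
  · refine integral_congr fun z hz => ?_
    have hz0 : z ≠ 0 := fun h => h0 (h ▸ hz)
    have hz1 : z - c / p ≠ 0 := fun h => hp (sub_eq_zero.1 h ▸ hz)
    have hz2 : c / z - p ≠ 0 := fun h => hz1 <| by
      rw [← sub_eq_zero.1 h, div_div_cancel₀ hc, sub_self]
    have hz3 : z * p - c ≠ 0 := fun h => hz1 <| by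
      rw [← sub_eq_zero.1 h, mul_div_cancel_right₀ _ hp0, sub_self]
    have hz4 : c - z * p ≠ 0 := fun h => hz3 (by rw [← neg_sub, h, neg_zero])
    have e1 : c / z - p = (c - z * p) / z := by field_simp
    have e2 : z - c / p = (z * p - c) / p := by field_simp
    rw [e1, e2, sub_zero]
    field_simp
    ring
  · simpa using C.continuousOn_zpow hp (-1)
  · simpa using C.continuousOn_zpow h0 (-1)

lemma integral_inv_inversion :
    (C.inversion hc h0).integral (fun x => (x - 0)⁻¹) = -(2 * π * Complex.I * C.winding 0) := by
  rw [integral_inversion, ← integral_inv_sub]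
  congr 1
  refine integral_congr fun z hz => ?_
  have hz0 : z ≠ 0 := fun h => h0 (h ▸ hz)
  field_simp
  simp [hc]

/-- Two curves together with a coefficient `s`, such that every point of `P` has total winding
number zero: Cauchy's theorem for functions whose singularities lie in `P`. -/
lemma integral_add_mul_integral_eq_zero {C D : JordanCurve} {s : ℂ} {K P : Set ℂ} [CompactSpace K]
    (hC : C.trace ⊆ K) (hD : D.trace ⊆ K) (hK : ∀ p ∈ P, p ∉ K) (hP : P.Nonempty)
    (hw : ∀ p ∈ P, C.integral (fun x => (x - p)⁻¹) + s * D.integral (fun x => (x - p)⁻¹) = 0)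
    {f : ℂ → ℂ} (hf : IsRationalLimit K P f) : C.integral f + s * D.integral f = 0 := by
  obtain ⟨Φ, hΦ⟩ := C.exists_integral_continuousLinearMap hC
  obtain ⟨Ψ, hΨ⟩ := D.exists_integral_continuousLinearMap hD
  obtain ⟨F, hF, hFf⟩ := hf
  rw [← hΦ F f hFf, ← hΨ F f hFf]
  refine apply_eq_zero_of_mem_rationalClosure hK hP (Φ + s • Ψ) (fun p hp n G hG => ?_) hF
  change Φ G + s * Ψ G = 0
  rw [hΦ G (fun z => (z - p) ^ n) hG, hΨ G (fun z => (z - p) ^ n) hG]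
  by_cases hn : n = -1
  · subst hn
    simpa only [zpow_neg_one] using hw p hp
  · rw [C.integral_zpow (fun h => hK p hp (hC h)) hn, D.integral_zpow (fun h => hK p hp (hD h)) hn]
    simp

/-- Invariance of the integral of `f(x) dx/x` under `x ↦ c / x`, if that map interchanges the
singularities of `f` inside and outside the curve. -/
lemma integral_comp_div (hc : c ≠ 0) (h0 : (0 : ℂ) ∉ C.trace) {P : Set ℂ} (hw0 : C.winding 0 = 1) (h0P : (0 : ℂ) ∈ P)
    (hP : ∀ p ∈ P, p ≠ 0 → p ∉ C.trace ∧ c / p ∉ C.trace ∧ C.winding p + C.winding (c / p) = 1)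
    {f : ℂ → ℂ} (hf : ∀ K : Set ℂ, ∀ _ : CompactSpace K, (∀ p ∈ P, p ∉ K) → IsRationalLimit K P f) :
    C.integral (fun x => f (c / x) / x) = C.integral (fun x => f x / x) := by
  set D := C.inversion hc h0
  have hcpt : CompactSpace ↑(C.trace ∪ D.trace) :=
    isCompact_iff_compactSpace.1 (C.isCompact_trace.union D.isCompact_trace)
  have hK : ∀ p ∈ P, p ∉ C.trace ∪ D.trace := by
    rintro p hp (h | h)
    · by_cases hp0 : p = 0
      · exact h0 (hp0 ▸ h)
      · exact (hP p hp hp0).1 h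
    · by_cases hp0 : p = 0
      · exact zero_notMem_trace_inversion hc h0 (hp0 ▸ h)
      · exact (hP p hp hp0).2.1 (mem_trace_inversion hc h0 h)
  -- The inverted curve winds `w(c/p) - 1` times around `p ≠ 0` and `-1` times around `0`, so adding
  -- the two curves cancels every winding number on `P`.
  have key := integral_add_mul_integral_eq_zero (C := C) (D := D) (s := 1) subset_union_left
    subset_union_right hK ⟨0, h0P⟩ (fun p hp => ?_)
    ((hf _ hcpt hK).mul (IsRationalLimit.inv hK h0P))
  · rw [one_mul, integral_inversion hc h0, ← sub_eq_add_neg, sub_eq_zero] at key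
    simp only [div_eq_mul_inv] at key ⊢
    rw [key]
    refine integral_congr fun z hz => ?_
    have hz0 : z ≠ 0 := fun h => h0 (h ▸ hz)
    field_simp
  · by_cases hp0 : p = 0
    · rw [hp0, integral_inv_inversion hc h0, integral_inv_sub]
      ring
    · rw [integral_inv_sub_inversion hc h0 hp0 (hP p hp hp0).2.1, integral_inv_sub, hw0]
      linear_combination (2 * π * Complex.I) * (hP p hp hp0).2.2

end JordanCurve

/-! ### The unit circle as a curve, and its winding numbers. -/

/-- The unit circle. -/
noncomputable def unitCircle : JordanCurve where
  param t := circleMap 0 1 (2 * π * t)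
  lipschitz := by
    refine ⟨‖(1 : ℝ)‖₊ * ‖2 * π‖₊, LipschitzOnWith.of_dist_le_mul fun s _ t _ => ?_⟩
    have := (lipschitzWith_circleMap 0 1).dist_le_mul (2 * π * s) (2 * π * t)
    refine this.trans (le_of_eq ?_)
    rw [Real.dist_eq, Real.dist_eq, ← mul_sub, abs_mul]
    simp [mul_assoc]
  closed := by simp [circleMap]
  simple := fun s hs t ht h => by
    have h2 : (0 : ℝ) < 2 * π := by positivity
    have hmem : ∀ u ∈ Ico (0 : ℝ) 1, 2 * π * u ∈ Ico 0 (2 * π) := fun u hu =>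
      ⟨mul_nonneg h2.le hu.1, by nlinarith [hu.2]⟩
    exact mul_left_cancel₀ h2.ne' (injOn_circleMap_of_abs_sub_le' (c := 0) one_ne_zero (a := 0)
      (b := 2 * π) (by simp) (hmem s hs) (hmem t ht) h)

lemma unitCircle_trace : unitCircle.trace = Metric.sphere 0 1 := by
  have h2 : (0 : ℝ) < 2 * π := by positivity
  ext z
  constructor
  · rintro ⟨t, -, rfl⟩
    exact circleMap_mem_sphere 0 zero_le_one _
  · intro hz
    rw [← abs_one, ← image_circleMap_Ioc] at hz
    obtain ⟨θ, hθ, rfl⟩ := hz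
    refine ⟨θ / (2 * π), ⟨div_nonneg hθ.1.le h2.le, (div_le_one h2).2 hθ.2⟩, ?_⟩
    simp only [unitCircle]
    rw [mul_div_cancel₀ _ h2.ne']

lemma unitCircle_integral (f : ℂ → ℂ) : unitCircle.integral f = ∮ z in C(0, 1), f z := by
  have hd : ∀ t : ℝ, deriv (fun t : ℝ => circleMap 0 1 (2 * π * t)) t
      = (2 * π) • deriv (circleMap 0 1) (2 * π * t) := fun t =>
    deriv_comp_mul_left (2 * π) (circleMap 0 1) t
  simp only [JordanCurve.integral, unitCircle, hd, circleIntegral]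
  have := intervalIntegral.smul_integral_comp_mul_left (a := 0) (b := 1)
    (fun θ => deriv (circleMap 0 1) θ • f (circleMap 0 1 θ)) (2 * π)
  rw [mul_zero, mul_one] at this
  rw [← this, ← intervalIntegral.integral_smul]
  refine intervalIntegral.integral_congr fun t _ => ?_
  simp only [smul_eq_mul, Complex.real_smul]
  ring

lemma unitCircle_winding_of_lt {p : ℂ} (hp : ‖p‖ < 1) : unitCircle.winding p = 1 := by
  have h := circleIntegral.integral_sub_inv_of_mem_ball (c := 0) (R := 1) (w := p) (by simpa using hp)
  simp only [JordanCurve.winding, one_div, unitCircle_integral, h]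
  exact inv_mul_cancel₀ Complex.two_pi_I_ne_zero

lemma unitCircle_winding_of_gt {p : ℂ} (hp : 1 < ‖p‖) : unitCircle.winding p = 0 := by
  simp only [JordanCurve.winding, one_div, unitCircle_integral]
  have hne : ∀ z ∈ Metric.closedBall (0 : ℂ) 1, z - p ≠ 0 := fun z hz h => by
    rw [sub_eq_zero.1 h, mem_closedBall_zero_iff] at hz
    exact hz.not_gt hp
  rw [Complex.circleIntegral_eq_zero_of_differentiable_on_off_countable zero_le_one
    countable_empty, mul_zero]
  · exact ContinuousOn.inv₀ (by fun_prop) hne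
  · intro z hz
    exact DifferentiableAt.inv (by fun_prop) (hne z (Metric.ball_subset_closedBall hz.1))

lemma continuous_qfac {q : ℂ} (hq : ‖q‖ < 1) : Continuous (qfac q) := by
  rw [continuous_iff_continuousAt]
  intro z
  have : CompactSpace ↑(Metric.closedBall z 1) := isCompact_iff_compactSpace.1
    (isCompact_closedBall z 1)
  obtain ⟨F, hF, -⟩ := exists_tendsto_qfac hq
    (⟨fun x => x, by fun_prop⟩ : C(↑(Metric.closedBall z 1), ℂ))
  have h : ContinuousOn (qfac q) (Metric.closedBall z 1) := by
    rw [continuousOn_iff_continuous_domRestrict]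
    exact F.continuous.congr hF
  exact h.continuousAt (Metric.closedBall_mem_nhds z one_pos)

/-! ### Curves that separate the two families of poles. -/

/-- The curve `C` winds once around the points `e q^k` and does not wind around their inverses. -/
structure Separates (C : JordanCurve) (q e : ℂ) : Prop where
  inside : ∀ k : ℕ, e * q ^ k ∉ C.trace ∧ C.winding (e * q ^ k) = 1
  -- For `e = 0` the convention `0⁻¹ = 0` would contradict `inside`; the guard allows parameters to
  -- become `0`.
  outside : e ≠ 0 → ∀ k : ℕ, (e * q ^ k)⁻¹ ∉ C.trace ∧ C.winding (e * q ^ k)⁻¹ = 0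

namespace Separates

variable {C : JordanCurve} {q e : ℂ}

lemma mul_base (h : Separates C q e) : Separates C q (e * q) where
  inside k := by simpa only [pow_succ', mul_assoc] using h.inside (k + 1)
  outside he k := by
    simpa only [pow_succ', mul_assoc] using h.outside (left_ne_zero_of_mul he) (k + 1)

lemma mul_base_pow (h : Separates C q e) (n : ℕ) : Separates C q (e * q ^ n) := by
  induction n with
  | zero => simpa using h
  | succ n ih => rw [pow_succ, ← mul_assoc]; exact ih.mul_base

lemma zero_notMem (h : Separates C q 0) : (0 : ℂ) ∉ C.trace := by simpa using (h.inside 0).1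

lemma winding_zero (h : Separates C q 0) : C.winding 0 = 1 := by simpa using (h.inside 0).2

lemma mul_mul_pow_ne_one (h : Separates C q e) {z : ℂ} (hz : z ∈ C.trace) (k : ℕ) :
    e * z * q ^ k ≠ 1 := fun h1 => by
  have he : e ≠ 0 := by rintro rfl; simp at h1
  refine (h.outside he k).1 ?_
  rwa [← eq_inv_of_mul_eq_one_right (a := e * q ^ k) (b := z) (by rw [← h1]; ring)]

lemma mul_inv_mul_pow_ne_one (h : Separates C q e) (h0 : Separates C q 0) {z : ℂ}
    (hz : z ∈ C.trace) (k : ℕ) : e * z⁻¹ * q ^ k ≠ 1 := fun h1 => by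
  have hz0 : z ≠ 0 := fun h => h0.zero_notMem (h ▸ hz)
  refine (h.inside k).1 ?_
  have : e * q ^ k = z := by
    field_simp at h1
    exact h1
  rwa [this]

lemma qfac_ne_zero (hq : ‖q‖ < 1) (h : Separates C q e) {z : ℂ} (hz : z ∈ C.trace) :
    qfac q (e * z) ≠ 0 :=
  AskeyWilson.qfac_ne_zero hq (h.mul_mul_pow_ne_one hz)

lemma qfac_inv_ne_zero (hq : ‖q‖ < 1) (h : Separates C q e) (h0 : Separates C q 0) {z : ℂ}
    (hz : z ∈ C.trace) : qfac q (e * z⁻¹) ≠ 0 :=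
  AskeyWilson.qfac_ne_zero hq (h.mul_inv_mul_pow_ne_one h0 hz)

end Separates

/-! ### The weight function and its `q`-difference equation. -/

section Weight

variable {q : ℂ}

lemma weight_swap_left (a b c d : ℂ) : weight q a b c d = weight q b a c d := by
  ext x; simp only [weight]; congr 1; ring

lemma weight_swap_middle (a b c d : ℂ) : weight q a b c d = weight q a c b d := by
  ext x; simp only [weight]; congr 1; ring

lemma weight_swap_right (a b c d : ℂ) : weight q a b c d = weight q a b d c := by
  ext x; simp only [weight]; congr 1; ring

variable {C : JordanCurve} {a b c d : ℂ}

lemma continuousOn_weight (hq : ‖q‖ < 1) (h0 : Separates C q 0)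
    (ha : Separates C q a) (hb : Separates C q b) (hc : Separates C q c) (hd : Separates C q d) :
    ContinuousOn (weight q a b c d) C.trace := by
  have hz : ∀ z ∈ C.trace, z ≠ 0 := fun z hz h => h0.zero_notMem (h ▸ hz)
  have hinv : ContinuousOn (fun z : ℂ => z⁻¹) C.trace := continuousOn_id.inv₀ hz
  have hQ := continuous_qfac hq
  have h1 : ∀ e : ℂ, ContinuousOn (fun z => qfac q (e * z)) C.trace := fun e =>
    hQ.comp_continuousOn' (continuousOn_const.mul continuousOn_id)
  have h2 : ∀ e : ℂ, ContinuousOn (fun z => qfac q (e * z⁻¹)) C.trace := fun e =>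
    hQ.comp_continuousOn' (continuousOn_const.mul hinv)
  have h3 : ContinuousOn (fun z : ℂ => qfac q (z ^ 2)) C.trace :=
    hQ.comp_continuousOn' (continuousOn_id.pow 2)
  have h4 : ContinuousOn (fun z : ℂ => qfac q (z⁻¹ ^ 2)) C.trace :=
    hQ.comp_continuousOn' (hinv.pow 2)
  change ContinuousOn (fun x => _ / _) C.trace
  refine ContinuousOn.div (h3.mul h4) ((((((((h1 a).mul (h2 a)).mul (h1 b)).mul (h2 b)).mul
    (h1 c)).mul (h2 c)).mul (h1 d)).mul (h2 d)) fun z hz => ?_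
  have g1 := fun {e} (he : Separates C q e) => he.qfac_ne_zero hq hz
  have g2 := fun {e} (he : Separates C q e) => he.qfac_inv_ne_zero hq h0 hz
  simp only [mul_ne_zero_iff]
  exact ⟨⟨⟨⟨⟨⟨⟨g1 ha, g2 ha⟩, g1 hb⟩, g2 hb⟩, g1 hc⟩, g2 hc⟩, g1 hd⟩, g2 hd⟩

/-- The weight function times `∏ (1 - e x) / (x (1 - x²))`, the product over the parameters `e`. -/
noncomputable def raisedWeight (q a b c d x : ℂ) : ℂ :=
  x⁻¹ * qfac q (q * x ^ 2) * qfac q (x⁻¹ ^ 2) *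
    ((qfac q (a * q * x))⁻¹ * (qfac q (a * x⁻¹))⁻¹) *
    ((qfac q (b * q * x))⁻¹ * (qfac q (b * x⁻¹))⁻¹) *
    ((qfac q (c * q * x))⁻¹ * (qfac q (c * x⁻¹))⁻¹) *
    ((qfac q (d * q * x))⁻¹ * (qfac q (d * x⁻¹))⁻¹)

/-- The substitution swaps `e q x` with `e/x`, so each parameter's pair of factors is invariant. The
sign comes from the prefactor `x⁻¹` and the two numerator products. -/
lemma raisedWeight_inv_div (hq : ‖q‖ < 1) (hq0 : q ≠ 0) {x : ℂ} (hx : x ≠ 0) :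
    raisedWeight q a b c d (q⁻¹ / x) = -raisedWeight q a b c d x := by
  have e1 : ∀ e : ℂ, e * q * (q⁻¹ / x) = e * x⁻¹ := fun e => by field_simp
  have e2 : ∀ e : ℂ, e * (q⁻¹ / x)⁻¹ = e * q * x := fun e => by field_simp
  have e3 : qfac q (q * (q⁻¹ / x) ^ 2) = (1 - q⁻¹ * x⁻¹ ^ 2) * qfac q (x⁻¹ ^ 2) := by
    rw [qfac_eq_mul hq]
    congr 2
    · field_simp
    · field_simp
  have e4 : qfac q (q * x ^ 2) = (1 - q * x ^ 2) * qfac q ((q⁻¹ / x)⁻¹ ^ 2) := by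
    rw [qfac_eq_mul hq]
    congr 2
    field_simp
  simp only [raisedWeight, e1, e2, e3, e4]
  have e5 : (q⁻¹ / x)⁻¹ * (1 - q⁻¹ * x⁻¹ ^ 2) = -(x⁻¹ * (1 - q * x ^ 2)) := by
    field_simp
    ring
  linear_combination (qfac q (x⁻¹ ^ 2) * qfac q ((q⁻¹ / x)⁻¹ ^ 2) *
    ((qfac q (a * q * x))⁻¹ * (qfac q (a * x⁻¹))⁻¹) *
    ((qfac q (b * q * x))⁻¹ * (qfac q (b * x⁻¹))⁻¹) *
    ((qfac q (c * q * x))⁻¹ * (qfac q (c * x⁻¹))⁻¹) *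
    ((qfac q (d * q * x))⁻¹ * (qfac q (d * x⁻¹))⁻¹)) * e5

/-- The singularities of the raised weight function. -/
def raisedPoles (q a b c d : ℂ) : Set ℂ :=
  {p | p = 0 ∨ ∃ e ∈ ({a, b, c, d} : Set ℂ), e ≠ 0 ∧
    ∃ k : ℕ, p = e * q ^ k ∨ p = (e * q ^ (k + 1))⁻¹}

section

variable {K P : Set ℂ} [CompactSpace K]

lemma isRationalLimit_qfac_mul_inv (hq : ‖q‖ < 1) (hq0 : q ≠ 0) (hK : ∀ p ∈ P, p ∉ K)
    (h0 : (0 : ℂ) ∈ P) {e : ℂ} (he : e ≠ 0 → ∀ k : ℕ, (e * q ^ (k + 1))⁻¹ ∈ P) :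
    IsRationalLimit K P (fun x => (qfac q (e * q * x))⁻¹) := by
  rcases eq_or_ne e 0 with rfl | he0
  · simpa using IsRationalLimit.const (K := K) (P := P) 1
  have hz : ∀ z : ℂ, ∀ k : ℕ, e * q * z * q ^ k = e * q ^ (k + 1) * z := fun z k => by ring
  have hne : ∀ k : ℕ, e * q ^ (k + 1) ≠ 0 := fun k => mul_ne_zero he0 (pow_ne_zero _ hq0)
  refine ((IsRationalLimit.const (e * q)).mul (IsRationalLimit.id h0)).qfac_inv hq ?_ fun k => ?_
  · intro z hzK k h1
    rw [hz] at h1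
    exact hK _ (he he0 k) (eq_inv_of_mul_eq_one_right h1 ▸ hzK)
  · refine ((IsRationalLimit.const (-(e * q ^ (k + 1)))⁻¹).mul
      (IsRationalLimit.inv_sub hK (he he0 k))).congr fun z _ => ?_
    rw [hz, ← mul_inv]
    congr 1
    have := hne k
    field_simp
    ring

lemma isRationalLimit_qfac_div_inv (hq : ‖q‖ < 1) (hK : ∀ p ∈ P, p ∉ K)
    (h0 : (0 : ℂ) ∈ P) {e : ℂ} (he : e ≠ 0 → ∀ k : ℕ, e * q ^ k ∈ P) :
    IsRationalLimit K P (fun x => (qfac q (e * x⁻¹))⁻¹) := by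
  rcases eq_or_ne e 0 with rfl | he0
  · simpa using IsRationalLimit.const (K := K) (P := P) 1
  have hz0 : ∀ z ∈ K, z ≠ 0 := fun z hz h => hK 0 h0 (h ▸ hz)
  refine ((IsRationalLimit.const e).mul (IsRationalLimit.inv hK h0)).qfac_inv hq ?_ fun k => ?_
  · intro z hzK k h1
    have := hz0 z hzK
    refine hK _ (he he0 k) ?_
    have h2 : e * q ^ k = z := by
      field_simp at h1
      exact h1
    rwa [h2]
  · refine ((IsRationalLimit.id h0).mul
      (IsRationalLimit.inv_sub hK (he he0 k))).congr fun z hz => ?_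
    have := hz0 z hz
    have e1 : 1 - e * z⁻¹ * q ^ k = z⁻¹ * (z - e * q ^ k) := by field_simp
    rw [e1, mul_inv, inv_inv]

lemma isRationalLimit_raisedWeight (hq : ‖q‖ < 1) (hq0 : q ≠ 0)
    (hK : ∀ p ∈ raisedPoles q a b c d, p ∉ K) :
    IsRationalLimit K (raisedPoles q a b c d) (raisedWeight q a b c d) := by
  have h0 : (0 : ℂ) ∈ raisedPoles q a b c d := Or.inl rfl
  have hi := IsRationalLimit.inv hK h0
  have key : ∀ e ∈ ({a, b, c, d} : Set ℂ), IsRationalLimit K (raisedPoles q a b c d)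
      (fun x => (qfac q (e * q * x))⁻¹ * (qfac q (e * x⁻¹))⁻¹) := fun e he =>
    (isRationalLimit_qfac_mul_inv hq hq0 hK h0
      fun he0 k => Or.inr ⟨e, he, he0, k, Or.inr rfl⟩).mul
    (isRationalLimit_qfac_div_inv hq hK h0 fun he0 k => Or.inr ⟨e, he, he0, k, Or.inl rfl⟩)
  exact ((((((hi.mul (((IsRationalLimit.const q).mul ((IsRationalLimit.id h0).pow 2)).qfac hq)).mul
    ((hi.pow 2).qfac hq)).mul (key a (by simp))).mul (key b (by simp))).mul
    (key c (by simp))).mul (key d (by simp)))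

end

/-- By oddness under `x ↦ q⁻¹/x` the first integral equals its own negative; `x ↦ 1/x` identifies
the second with the first. -/
lemma integral_raisedWeight (hq : ‖q‖ < 1) (hq0 : q ≠ 0) (h0 : Separates C q 0)
    (hsep : ∀ e ∈ ({a, b, c, d} : Set ℂ), Separates C q e) :
    C.integral (fun x => raisedWeight q a b c d x / x) = 0 ∧
      C.integral (fun x => raisedWeight q a b c d (1 / x) / x) = 0 := by
  have h1 : C.integral (fun x => raisedWeight q a b c d x / x) = 0 := by
    have h := JordanCurve.integral_comp_div (inv_ne_zero hq0) h0.zero_notMem h0.winding_zero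
      (P := raisedPoles q a b c d) (Or.inl rfl) ?_
      (fun K _ hK => isRationalLimit_raisedWeight hq hq0 hK)
    · have h2 : C.integral (fun x => raisedWeight q a b c d (q⁻¹ / x) / x)
          = -C.integral (fun x => raisedWeight q a b c d x / x) := by
        rw [← C.integral_neg]
        refine JordanCurve.integral_congr fun z hz => ?_
        rw [raisedWeight_inv_div hq hq0 (fun h => h0.zero_notMem (h ▸ hz)), neg_div]
      rw [h2] at h
      exact self_eq_neg.1 h.symm
    · rintro p (rfl | ⟨e, he, he0, k, rfl | rfl⟩) hp0
      · exact absurd rfl hp0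
      · have : q⁻¹ / (e * q ^ k) = (e * q ^ (k + 1))⁻¹ := by field_simp; ring
        have i := (hsep e he).inside k
        have o := (hsep e he).outside he0 (k + 1)
        rw [this, i.2, o.2, add_zero]
        exact ⟨i.1, o.1, rfl⟩
      · have : q⁻¹ / (e * q ^ (k + 1))⁻¹ = e * q ^ k := by field_simp; ring
        have i := (hsep e he).inside k
        have o := (hsep e he).outside he0 (k + 1)
        rw [this, i.2, o.2, zero_add]
        exact ⟨o.1, i.1, rfl⟩
  refine ⟨h1, ?_⟩
  rw [← h1]
  refine JordanCurve.integral_comp_div one_ne_zero h0.zero_notMem h0.winding_zero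
    (P := raisedPoles q a b c d) (Or.inl rfl) ?_
    (fun K _ hK => isRationalLimit_raisedWeight hq hq0 hK)
  rintro p (rfl | ⟨e, he, he0, k, rfl | rfl⟩) hp0
  · exact absurd rfl hp0
  -- For `k = 0` the image `e⁻¹` is not among the listed poles, but the curve does not wind around
  -- it either, which is all that is needed.
  · have i := (hsep e he).inside k
    have o := (hsep e he).outside he0 k
    rw [one_div, i.2, o.2, add_zero]
    exact ⟨i.1, o.1, rfl⟩
  · have i := (hsep e he).inside (k + 1)
    have o := (hsep e he).outside he0 (k + 1)
    rw [one_div, inv_inv, i.2, o.2, zero_add]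
    exact ⟨o.1, i.1, rfl⟩

/-- `Δ₊` is invariant under `x ↦ 1/x`. Once it is factored out, the Laurent polynomial identity
`key` remains. -/
lemma raisedWeight_add_raisedWeight_inv (hq : ‖q‖ < 1) (h0 : Separates C q 0)
    (hsep : ∀ e ∈ ({a, b, c, d} : Set ℂ), Separates C q e) {x : ℂ} (hx : x ∈ C.trace) :
    raisedWeight q a b c d x + raisedWeight q a b c d (1 / x) =
      ((1 - a * b * c * d) * (x + x⁻¹) -
        (a + b + c + d - (a * b * c + a * b * d + a * c * d + b * c * d))) *
      weight q a b c d x := by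
  have hx0 : x ≠ 0 := fun h => h0.zero_notMem (h ▸ hx)
  have f1 : ∀ e : ℂ, qfac q (e * x) = (1 - e * x) * qfac q (e * q * x) := fun e => by
    rw [qfac_eq_mul hq, mul_right_comm]
  have f2 : ∀ e : ℂ, qfac q (e * x⁻¹) = (1 - e * x⁻¹) * qfac q (e * q * x⁻¹) := fun e => by
    rw [qfac_eq_mul hq, mul_right_comm]
  have f3 : qfac q (x ^ 2) = (1 - x ^ 2) * qfac q (q * x ^ 2) := by
    rw [qfac_eq_mul hq, mul_comm q]
  have f4 : qfac q (x⁻¹ ^ 2) = (1 - x⁻¹ ^ 2) * qfac q (q * x⁻¹ ^ 2) := by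
    rw [qfac_eq_mul hq, mul_comm q]
  have n1 : ∀ e ∈ ({a, b, c, d} : Set ℂ), 1 - e * x ≠ 0 := fun e he h => by
    have := (hsep e he).qfac_ne_zero hq hx
    rw [f1, h, zero_mul] at this
    exact this rfl
  have n2 : ∀ e ∈ ({a, b, c, d} : Set ℂ), 1 - e * x⁻¹ ≠ 0 := fun e he h => by
    have := (hsep e he).qfac_inv_ne_zero hq h0 hx
    rw [f2, h, zero_mul] at this
    exact this rfl
  have g1 : ∀ e ∈ ({a, b, c, d} : Set ℂ), (qfac q (e * q * x))⁻¹ * (qfac q (e * x⁻¹))⁻¹ =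
      (1 - e * x) * (qfac q (e * x) * qfac q (e * x⁻¹))⁻¹ := fun e he => by
    rw [f1 e, mul_inv, mul_inv, ← mul_assoc, ← mul_assoc, mul_inv_cancel₀ (n1 e he), one_mul]
  have g2 : ∀ e ∈ ({a, b, c, d} : Set ℂ), (qfac q (e * q * x⁻¹))⁻¹ * (qfac q (e * x))⁻¹ =
      (1 - e * x⁻¹) * (qfac q (e * x) * qfac q (e * x⁻¹))⁻¹ := fun e he => by
    rw [f2 e, mul_comm (qfac q (e * x)), mul_inv, mul_inv, ← mul_assoc, ← mul_assoc,
      mul_inv_cancel₀ (n2 e he), one_mul]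
  simp only [raisedWeight, weight, one_div, inv_inv]
  rw [g1 a (by simp), g1 b (by simp), g1 c (by simp), g1 d (by simp),
    g2 a (by simp), g2 b (by simp), g2 c (by simp), g2 d (by simp), f3, f4]
  simp only [div_eq_mul_inv, mul_inv]
  generalize (qfac q (a * x))⁻¹ = A₁
  generalize (qfac q (b * x))⁻¹ = B₁
  generalize (qfac q (c * x))⁻¹ = C₁
  generalize (qfac q (d * x))⁻¹ = D₁
  generalize (qfac q (a * x⁻¹))⁻¹ = A₂
  generalize (qfac q (b * x⁻¹))⁻¹ = B₂
  generalize (qfac q (c * x⁻¹))⁻¹ = C₂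
  generalize (qfac q (d * x⁻¹))⁻¹ = D₂
  generalize qfac q (q * x ^ 2) = S
  generalize qfac q (q * x⁻¹ ^ 2) = U
  have key : x⁻¹ * (1 - x⁻¹ ^ 2) * ((1 - a * x) * (1 - b * x) * (1 - c * x) * (1 - d * x)) +
      x * (1 - x ^ 2) * ((1 - a * x⁻¹) * (1 - b * x⁻¹) * (1 - c * x⁻¹) * (1 - d * x⁻¹)) =
      ((1 - a * b * c * d) * (x + x⁻¹) -
        (a + b + c + d - (a * b * c + a * b * d + a * c * d + b * c * d))) *
      ((1 - x ^ 2) * (1 - x⁻¹ ^ 2)) := by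
    field_simp
    ring
  linear_combination (S * U * A₁ * A₂ * B₁ * B₂ * C₁ * C₂ * D₁ * D₂) * key

lemma weight_mul_base (hq : ‖q‖ < 1) (h0 : Separates C q 0) (ha : Separates C q a)
    {x : ℂ} (hx : x ∈ C.trace) :
    weight q (a * q) b c d x = (1 - a * x) * (1 - a * x⁻¹) * weight q a b c d x := by
  have f1 : qfac q (a * x) = (1 - a * x) * qfac q (a * q * x) := by
    rw [qfac_eq_mul hq, mul_right_comm]
  have f2 : qfac q (a * x⁻¹) = (1 - a * x⁻¹) * qfac q (a * q * x⁻¹) := by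
    rw [qfac_eq_mul hq, mul_right_comm]
  have n1 := left_ne_zero_of_mul (f1 ▸ ha.qfac_ne_zero hq hx)
  have n2 := left_ne_zero_of_mul (f2 ▸ ha.qfac_inv_ne_zero hq h0 hx)
  have g1 : (qfac q (a * q * x))⁻¹ = (1 - a * x) * (qfac q (a * x))⁻¹ := by
    rw [f1, mul_inv, mul_inv_cancel_left₀ n1]
  have g2 : (qfac q (a * q * x⁻¹))⁻¹ = (1 - a * x⁻¹) * (qfac q (a * x⁻¹))⁻¹ := by
    rw [f2, mul_inv, mul_inv_cancel_left₀ n2]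
  simp only [weight, div_eq_mul_inv, mul_inv, g1, g2]
  ring

/-- `(1 - abcd)(1 - ax)(1 - a/x) - (1 - ab)(1 - ac)(1 - ad)` equals `-a` times the Laurent
polynomial in `raisedWeight_add_raisedWeight_inv`, so the difference of the two sides integrates to
zero. -/
lemma integral_weight_mul_base (hq : ‖q‖ < 1) (hq0 : q ≠ 0) (h0 : Separates C q 0)
    (hsep : ∀ e ∈ ({a, b, c, d} : Set ℂ), Separates C q e) :
    (1 - a * b * c * d) * C.integral (fun x => weight q (a * q) b c d x / x) =
      (1 - a * b) * (1 - a * c) * (1 - a * d) * C.integral (fun x => weight q a b c d x / x) := by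
  obtain ⟨h1, h2⟩ := integral_raisedWeight hq hq0 h0 hsep
  have hx0 : ∀ x ∈ C.trace, x ≠ 0 := fun x hx h => h0.zero_notMem (h ▸ hx)
  have ha := hsep a (by simp)
  have hcpt : CompactSpace C.trace := isCompact_iff_compactSpace.1 C.isCompact_trace
  have hpoles : ∀ p ∈ raisedPoles q a b c d, p ∉ C.trace := by
    rintro p (rfl | ⟨e, he, he0, k, rfl | rfl⟩)
    · exact h0.zero_notMem
    · exact ((hsep e he).inside k).1
    · exact ((hsep e he).outside he0 (k + 1)).1
  have hcG : ContinuousOn (fun x => raisedWeight q a b c d x / x) C.trace := by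
    obtain ⟨F, -, hF⟩ := isRationalLimit_raisedWeight (a := a) (b := b) (c := c) (d := d)
      hq hq0 hpoles
    refine ContinuousOn.div ?_ continuousOn_id hx0
    rw [continuousOn_iff_continuous_domRestrict]
    exact F.continuous.congr hF
  have hcW : ∀ a, Separates C q a → ContinuousOn (fun x => weight q a b c d x / x) C.trace :=
    fun a ha => (continuousOn_weight hq h0 ha (hsep b (by simp)) (hsep c (by simp))
      (hsep d (by simp))).div continuousOn_id hx0
  have h3 := C.integral_sub ((hcW _ ha.mul_base).const_mul (1 - a * b * c * d))
    ((hcW _ ha).const_mul ((1 - a * b) * (1 - a * c) * (1 - a * d)))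
  rw [C.integral_const_mul, C.integral_const_mul] at h3
  rw [← sub_eq_zero, ← h3]
  have hval : ∀ x ∈ C.trace, (1 - a * b * c * d) * (weight q (a * q) b c d x / x) -
      (1 - a * b) * (1 - a * c) * (1 - a * d) * (weight q a b c d x / x) =
      -a * (raisedWeight q a b c d x / x + raisedWeight q a b c d (1 / x) / x) := fun x hx => by
    rw [← add_div, raisedWeight_add_raisedWeight_inv hq h0 hsep hx,
      weight_mul_base hq h0 ha hx]
    have := hx0 x hx
    field_simp
    ring
  have hcG' : ContinuousOn (fun x => raisedWeight q a b c d (1 / x) / x) C.trace := by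
    have hW := hcW a ha
    have hcoef : ContinuousOn (fun x : ℂ => (1 - a * b * c * d) * (x + x⁻¹) -
        (a + b + c + d - (a * b * c + a * b * d + a * c * d + b * c * d))) C.trace :=
      (continuousOn_const.mul (continuousOn_id.add (continuousOn_id.inv₀ hx0))).sub
        continuousOn_const
    refine ((hcoef.mul hW).sub hcG).congr fun x hx => ?_
    have := raisedWeight_add_raisedWeight_inv hq h0 hsep hx
    rw [← eq_sub_iff_add_eq'] at this
    simp only [this, Pi.sub_apply, Pi.mul_apply]
    ring
  rw [JordanCurve.integral_congr hval, C.integral_const_mul, C.integral_add hcG hcG', h1, h2]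
  simp

end Weight

/-! ### Iterating the difference equation to remove the parameters. -/

section Weight

variable {q : ℂ} {C : JordanCurve} {a b c d : ℂ}

lemma weight_mul_base_pow (hq : ‖q‖ < 1) (h0 : Separates C q 0) (ha : Separates C q a)
    {x : ℂ} (hx : x ∈ C.trace) (n : ℕ) :
    weight q (a * q ^ n) b c d x = (∏ k ∈ Finset.range n, (1 - q ^ k * (a * x))) *
      (∏ k ∈ Finset.range n, (1 - q ^ k * (a * x⁻¹))) * weight q a b c d x := by
  induction n with
  | zero => simp
  | succ n ih =>
    rw [pow_succ, ← mul_assoc, weight_mul_base hq h0 (ha.mul_base_pow n) hx, ih,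
      Finset.prod_range_succ, Finset.prod_range_succ]
    ring

lemma weight_zero_left (hq : ‖q‖ < 1) (h0 : Separates C q 0) (ha : Separates C q a)
    {x : ℂ} (hx : x ∈ C.trace) :
    weight q 0 b c d x = qfac q (a * x) * qfac q (a * x⁻¹) * weight q a b c d x := by
  have h1 := ha.qfac_ne_zero hq hx
  have h2 := ha.qfac_inv_ne_zero hq h0 hx
  simp only [weight, zero_mul, qfac_zero_right, div_eq_mul_inv, mul_inv, inv_one]
  linear_combination (-(qfac q (x ^ 2) * qfac q (x⁻¹ ^ 2) * (qfac q (b * x))⁻¹ *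
    (qfac q (b * x⁻¹))⁻¹ * (qfac q (c * x))⁻¹ * (qfac q (c * x⁻¹))⁻¹ * (qfac q (d * x))⁻¹ *
    (qfac q (d * x⁻¹))⁻¹)) * ((qfac q (a * x⁻¹) * (qfac q (a * x⁻¹))⁻¹) * mul_inv_cancel₀ h1
      + mul_inv_cancel₀ h2)

/-- Relative to the weight with parameter `a`, the weights with `a qⁿ` are multiplied by partial
products of `(ax, a/x; q)_∞`, which converge uniformly on the curve. -/
lemma tendsto_integral_weight (hq : ‖q‖ < 1) (h0 : Separates C q 0)
    (ha : Separates C q a) (hb : Separates C q b) (hc : Separates C q c) (hd : Separates C q d) :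
    Tendsto (fun n : ℕ => C.integral fun x => weight q (a * q ^ n) b c d x / x) atTop
      (𝓝 (C.integral fun x => weight q 0 b c d x / x)) := by
  have hx0 : ∀ x ∈ C.trace, x ≠ 0 := fun x hx h => h0.zero_notMem (h ▸ hx)
  have : CompactSpace C.trace := isCompact_iff_compactSpace.1 C.isCompact_trace
  have hW : ContinuousOn (fun x => weight q a b c d x / x) C.trace :=
    (continuousOn_weight hq h0 ha hb hc hd).div continuousOn_id hx0
  have hI : ContinuousOn (fun x : ℂ => a * x⁻¹) C.trace :=
    continuousOn_const.mul (continuousOn_id.inv₀ hx0)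
  obtain ⟨Φ, hΦ⟩ := C.exists_integral_continuousLinearMap subset_rfl
  obtain ⟨X, hX⟩ : ∃ X : C(C.trace, ℂ), ∀ x, X x = a * x := ⟨⟨fun x => a * x, by fun_prop⟩,
    fun _ => rfl⟩
  obtain ⟨Y, hY⟩ : ∃ Y : C(C.trace, ℂ), ∀ x, Y x = a * (x : ℂ)⁻¹ :=
    ⟨⟨_, continuousOn_iff_continuous_domRestrict.1 hI⟩, fun _ => rfl⟩
  obtain ⟨W, hWx⟩ : ∃ W : C(C.trace, ℂ), ∀ x, W x = weight q a b c d x / x :=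
    ⟨⟨_, continuousOn_iff_continuous_domRestrict.1 hW⟩, fun _ => rfl⟩
  obtain ⟨F, hF, hFt⟩ := exists_tendsto_qfac hq X
  obtain ⟨G, hG, hGt⟩ := exists_tendsto_qfac hq Y
  have h := (Φ.continuous.tendsto _).comp ((hFt.mul hGt).mul_const W)
  rw [hΦ _ (fun x => weight q 0 b c d x / x)] at h
  · refine h.congr fun n => hΦ _ _ fun x => ?_
    rw [weight_mul_base_pow hq h0 ha x.2]
    simp [ContinuousMap.prod_apply, hX, hY, hWx, mul_div_assoc]
  · intro x
    rw [weight_zero_left hq h0 ha x.2]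
    simp [hF, hG, hX, hY, hWx, mul_div_assoc]

lemma integral_weight_mul_base_pow (hq : ‖q‖ < 1) (hq0 : q ≠ 0) (h0 : Separates C q 0)
    (ha : Separates C q a) (hb : Separates C q b) (hc : Separates C q c) (hd : Separates C q d)
    (n : ℕ) :
    (∏ k ∈ Finset.range n, (1 - a * b * c * d * q ^ k)) *
        C.integral (fun x => weight q (a * q ^ n) b c d x / x) =
      (∏ k ∈ Finset.range n, (1 - a * b * q ^ k)) * (∏ k ∈ Finset.range n, (1 - a * c * q ^ k)) *
        (∏ k ∈ Finset.range n, (1 - a * d * q ^ k)) *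
          C.integral (fun x => weight q a b c d x / x) := by
  induction n with
  | zero => simp
  | succ n ih =>
    have h := integral_weight_mul_base (a := a * q ^ n) (b := b) (c := c) (d := d) hq hq0 h0 (by
      rintro e (rfl | rfl | rfl | rfl)
      exacts [ha.mul_base_pow n, hb, hc, hd])
    simp only [Finset.prod_range_succ]
    rw [pow_succ q n, ← mul_assoc a]
    linear_combination (∏ k ∈ Finset.range n, (1 - a * b * c * d * q ^ k)) * h +
      (1 - a * b * q ^ n) * (1 - a * c * q ^ n) * (1 - a * d * q ^ n) * ih

lemma qfac_mul_integral_weight_zero_left (hq : ‖q‖ < 1) (hq0 : q ≠ 0) (h0 : Separates C q 0)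
    (ha : Separates C q a) (hb : Separates C q b) (hc : Separates C q c) (hd : Separates C q d) :
    qfac q (a * b * c * d) * C.integral (fun x => weight q 0 b c d x / x) =
      qfac q (a * b) * qfac q (a * c) * qfac q (a * d) *
        C.integral (fun x => weight q a b c d x / x) :=
  tendsto_nhds_unique_of_eventuallyEq
    ((tendsto_qfac hq _).mul (tendsto_integral_weight hq h0 ha hb hc hd))
    ((((tendsto_qfac hq _).mul (tendsto_qfac hq _)).mul (tendsto_qfac hq _)).mul_const _)
    (Eventually.of_forall (integral_weight_mul_base_pow hq hq0 h0 ha hb hc hd))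

/-- Reduction of the Askey–Wilson integral to the integral without parameters. -/
lemma qfac_mul_integral_weight_zero (hq : ‖q‖ < 1) (hq0 : q ≠ 0) (h0 : Separates C q 0)
    (ha : Separates C q a) (hb : Separates C q b) (hc : Separates C q c) (hd : Separates C q d) :
    qfac q (a * b * c * d) * C.integral (fun x => weight q 0 0 0 0 x / x) =
      qfac q (a * b) * qfac q (a * c) * qfac q (a * d) * qfac q (b * c) * qfac q (b * d) *
        qfac q (c * d) * C.integral (fun x => weight q a b c d x / x) := by
  -- The parameters are removed one at a time; a factor containing a parameter already set to `0`
  -- becomes `1`.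
  have h1 := qfac_mul_integral_weight_zero_left hq hq0 h0 ha hb hc hd
  have h2 := qfac_mul_integral_weight_zero_left hq hq0 h0 hb h0 hc hd
  have h3 := qfac_mul_integral_weight_zero_left hq hq0 h0 hc h0 h0 hd
  have h4 := qfac_mul_integral_weight_zero_left hq hq0 h0 hd h0 h0 h0
  rw [weight_swap_left b] at h2
  rw [weight_swap_left c, weight_swap_middle 0 c] at h3
  rw [weight_swap_left d, weight_swap_middle 0 d, weight_swap_right 0 0 d] at h4
  simp only [mul_zero, zero_mul, qfac_zero_right, one_mul, mul_one] at h2 h3 h4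
  rw [h4, h3, h2]
  linear_combination (qfac q (b * c) * qfac q (b * d) * qfac q (c * d)) * h1

end Weight

/-! ### Evaluation of the integral without parameters. -/

section NoParameters

variable {q : ℂ}

lemma separates_unitCircle (hq : ‖q‖ < 1) (hq0 : q ≠ 0) {e : ℂ} (he : ‖e‖ < 1) :
    Separates unitCircle q e := by
  have h : ∀ k : ℕ, ‖e * q ^ k‖ < 1 := fun k => by
    rw [norm_mul, norm_pow]
    exact mul_lt_one_of_nonneg_of_lt_one_left (norm_nonneg _) he
      (pow_le_one₀ (norm_nonneg _) hq.le)
  refine ⟨fun k => ⟨?_, unitCircle_winding_of_lt (h k)⟩, fun he0 k => ?_⟩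
  · rw [unitCircle_trace, mem_sphere_zero_iff_norm]
    exact (h k).ne
  · have h1 : 1 < ‖(e * q ^ k)⁻¹‖ := by
      rw [norm_inv]
      exact (one_lt_inv₀ (norm_pos_iff.2 (mul_ne_zero he0 (pow_ne_zero _ hq0)))).2 (h k)
    refine ⟨?_, unitCircle_winding_of_gt h1⟩
    rw [unitCircle_trace, mem_sphere_zero_iff_norm]
    exact h1.ne'

lemma weight_zero_eq (x : ℂ) : weight q 0 0 0 0 x = qfac q (x ^ 2) * qfac q (x⁻¹ ^ 2) := by
  simp [weight]

/-- The only singularity is `0`, around which both curves wind once. -/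
lemma integral_weight_zero_eq_unitCircle (hq : ‖q‖ < 1) {C : JordanCurve}
    (h0 : (0 : ℂ) ∉ C.trace) (hw : C.winding 0 = 1) :
    C.integral (fun x => weight q 0 0 0 0 x / x) =
      unitCircle.integral (fun x => weight q 0 0 0 0 x / x) := by
  have : CompactSpace ↑(C.trace ∪ unitCircle.trace) :=
    isCompact_iff_compactSpace.1 (C.isCompact_trace.union unitCircle.isCompact_trace)
  have h01 : (0 : ℂ) ∉ unitCircle.trace := by simp [unitCircle_trace]
  have hK : ∀ p ∈ ({0} : Set ℂ), p ∉ C.trace ∪ unitCircle.trace := by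
    rintro p rfl (h | h)
    exacts [h0 h, h01 h]
  have hid := IsRationalLimit.id (K := C.trace ∪ unitCircle.trace) (mem_singleton (0 : ℂ))
  have hinv := IsRationalLimit.inv hK (mem_singleton (0 : ℂ))
  have key := JordanCurve.integral_add_mul_integral_eq_zero (C := C) (D := unitCircle) (s := -1)
    subset_union_left subset_union_right hK (singleton_nonempty _) (fun p hp => ?_)
    ((((hid.pow 2).qfac hq).mul ((hinv.pow 2).qfac hq)).mul hinv)
  · simp only [weight_zero_eq, div_eq_mul_inv]
    linear_combination key
  · rw [mem_singleton_iff.1 hp, C.integral_inv_sub, unitCircle.integral_inv_sub, hw,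
      unitCircle_winding_of_lt (by simp)]
    ring

/-- Comparison of the bases `q` and `q²`, from the parameters `0, 0, √q, -√q`. -/
lemma integral_weight_zero_mul_qfac_sq (hq : ‖q‖ < 1) (hq0 : q ≠ 0) :
    unitCircle.integral (fun x => weight q 0 0 0 0 x / x) * qfac q q =
      unitCircle.integral (fun x => weight (q ^ 2) 0 0 0 0 x / x) * qfac (q ^ 2) (q ^ 2) := by
  obtain ⟨r, hr⟩ : ∃ r, r ^ 2 = q := IsAlgClosed.exists_pow_nat_eq q two_pos
  have hr1 : ‖r‖ < 1 := by
    rw [← hr, norm_pow] at hq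
    exact lt_of_pow_lt_pow_left₀ 2 zero_le_one (by simpa using hq)
  have h0 := separates_unitCircle hq hq0 (e := 0) (by simp)
  have hs := separates_unitCircle hq hq0 hr1
  have hs' := separates_unitCircle hq hq0 (e := -r) (by simpa using hr1)
  have h := qfac_mul_integral_weight_zero hq hq0 h0 h0 h0 hs hs'
  simp only [zero_mul, mul_zero, qfac_zero_right, one_mul] at h
  have hW : ∀ x ∈ unitCircle.trace, weight q 0 0 r (-r) x / x = weight (q ^ 2) 0 0 0 0 x / x := by
    intro x hx
    have n1 := hs.qfac_ne_zero hq hx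
    have n2 := hs'.qfac_ne_zero hq hx
    have n3 := hs.qfac_inv_ne_zero hq h0 hx
    have n4 := hs'.qfac_inv_ne_zero hq h0 hx
    -- The odd-index factors of `(x²; q)_∞` form `(q x²; q²)_∞ = (rx, -rx; q)_∞`, which the
    -- denominator cancels.
    have e1 : qfac q (x ^ 2) = qfac (q ^ 2) (x ^ 2) * (qfac q (r * x) * qfac q (-r * x)) := by
      rw [qfac_eq_mul_sq hq, neg_mul, qfac_mul_qfac_neg hq, mul_pow, hr, mul_comm q]
    have e2 : qfac q (x⁻¹ ^ 2) =
        qfac (q ^ 2) (x⁻¹ ^ 2) * (qfac q (r * x⁻¹) * qfac q (-r * x⁻¹)) := by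
      rw [qfac_eq_mul_sq hq, neg_mul, qfac_mul_qfac_neg hq, mul_pow, hr, mul_comm q]
    rw [weight_zero_eq]
    simp only [weight, zero_mul, qfac_zero_right, one_mul]
    rw [e1, e2]
    congr 1
    rw [div_eq_iff (mul_ne_zero (mul_ne_zero (mul_ne_zero n1 n3) n2) n4)]
    ring
  -- The only nontrivial constant is `(-r²; q)_∞ = (-q; q)_∞`, and `(q, -q; q)_∞ = (q²; q²)_∞`.
  rw [JordanCurve.integral_congr hW, mul_neg, ← sq, hr] at h
  rw [h, ← qfac_mul_qfac_neg hq]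
  ring

/-- As the base tends to `0`, dominated convergence leaves only the factor `k = 0`, where `0 ^ 0 =
1`. Both fixed and varying `u` are needed: functions on the circle, and the base itself for `(s;
s)_∞`. -/
lemma tendsto_tprod_one_sub_pow_smul {R : Type*} [NormedCommRing R] [NormOneClass R]
    [CompleteSpace R] [NormedAlgebra ℂ R] {s : ℕ → ℂ} {ρ B : ℝ} (hρ : ρ < 1)
    (hsρ : ∀ m, ‖s m‖ ≤ ρ) (hs : Tendsto s atTop (𝓝 0)) {u : ℕ → R} {v : R}
    (hu : Tendsto u atTop (𝓝 v)) (hB : ∀ m, ‖u m‖ ≤ B) :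
    Tendsto (fun m => ∏' k : ℕ, (1 + -(s m ^ k • u m))) atTop (𝓝 (1 - v)) := by
  have hρ0 : 0 ≤ ρ := (norm_nonneg _).trans (hsρ 0)
  have h := tendsto_tprod_one_add_of_dominated_convergence (𝓕 := atTop)
    (f := fun m k => -(s m ^ k • u m)) (g := fun k => -((0 : ℂ) ^ k • v))
    (bound := fun k => ρ ^ k * B) ((summable_geometric_of_lt_one hρ0 hρ).mul_right _)
    (fun k => ((hs.pow k).smul hu).neg) (Eventually.of_forall fun m k => by
      rw [norm_neg, norm_smul, norm_pow]
      exact mul_le_mul (pow_le_pow_left₀ (norm_nonneg _) (hsρ m) k) (hB m) (norm_nonneg _)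
        (pow_nonneg hρ0 k))
  rwa [tprod_eq_mulSingle 0 fun k hk => by simp [hk], pow_zero, one_smul, ← sub_eq_add_neg] at h

lemma integral_weight_zero_mul_qfac (hq : ‖q‖ < 1) (hq0 : q ≠ 0) :
    unitCircle.integral (fun x => weight q 0 0 0 0 x / x) * qfac q q =
      2 * (2 * π * Complex.I) := by
  set s : ℕ → ℂ := fun m => q ^ 2 ^ m
  have hsρ : ∀ m, ‖s m‖ ≤ ‖q‖ := fun m => by
    simp only [s, norm_pow]
    exact pow_le_of_le_one (norm_nonneg _) hq.le (by positivity)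
  have hs1 : ∀ m, ‖s m‖ < 1 := fun m => (hsρ m).trans_lt hq
  have hs : Tendsto s atTop (𝓝 0) := (tendsto_pow_atTop_nhds_zero_of_norm_lt_one hq).comp
    (tendsto_pow_atTop_atTop_of_one_lt one_lt_two)
  have hconst : ∀ m, unitCircle.integral (fun x => weight (s m) 0 0 0 0 x / x) *
      qfac (s m) (s m) = unitCircle.integral (fun x => weight q 0 0 0 0 x / x) * qfac q q := by
    intro m
    induction m with
    | zero => simp [s]
    | succ m ih =>
      have : s (m + 1) = s m ^ 2 := by simp only [s, ← pow_mul, pow_succ 2 m]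
      rw [this, ← integral_weight_zero_mul_qfac_sq (hs1 m) (pow_ne_zero _ hq0), ih]
  have h01 : (0 : ℂ) ∉ unitCircle.trace := by simp [unitCircle_trace]
  have hx0 : ∀ x : unitCircle.trace, (x : ℂ) ≠ 0 := fun x h => h01 (h ▸ x.2)
  have : CompactSpace unitCircle.trace :=
    isCompact_iff_compactSpace.1 unitCircle.isCompact_trace
  have : Nonempty unitCircle.trace := ⟨⟨1, by simp [unitCircle_trace]⟩⟩
  have := normOneClass_continuousMap (T := unitCircle.trace)
  obtain ⟨Φ, hΦ⟩ := unitCircle.exists_integral_continuousLinearMap subset_rfl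
  let X : C(unitCircle.trace, ℂ) := ⟨fun x => (x : ℂ) ^ 2, by fun_prop⟩
  let Y : C(unitCircle.trace, ℂ) :=
    ⟨fun x => (x : ℂ)⁻¹ ^ 2, by fun_prop (disch := exact hx0 _)⟩
  let Z : C(unitCircle.trace, ℂ) := ⟨fun x => (x : ℂ)⁻¹, by fun_prop (disch := exact hx0 _)⟩
  have hlim : ∀ U : C(unitCircle.trace, ℂ),
      Tendsto (fun m => ∏' k : ℕ, (1 + -(s m ^ k • U))) atTop (𝓝 (1 - U)) := fun U =>
    tendsto_tprod_one_sub_pow_smul hq hsρ hs tendsto_const_nhds fun _ => le_rfl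
  have hval : ∀ (U : C(unitCircle.trace, ℂ)) m x,
      (∏' k : ℕ, (1 + -(s m ^ k • U))) x = qfac (s m) (U x) := fun U m x => by
    rw [tprod_continuousMap_apply, qfac]
    · exact tprod_congr fun k => by
        simp only [ContinuousMap.neg_apply, ContinuousMap.smul_apply, smul_eq_mul]; ring
    · simp only [norm_neg, norm_smul, norm_pow]
      exact (summable_geometric_of_lt_one (norm_nonneg _) (hs1 m)).mul_right _
  have h1 := (Φ.continuous.tendsto _).comp (((hlim X).mul (hlim Y)).mul_const Z)
  have h2 : Tendsto (fun m => qfac (s m) (s m)) atTop (𝓝 1) := by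
    have := tendsto_tprod_one_sub_pow_smul hq hsρ hs hs hsρ
    rw [sub_zero] at this
    refine this.congr fun m => tprod_congr fun k => ?_
    rw [smul_eq_mul]
    ring
  have h3 := h1.mul h2
  refine (tendsto_nhds_unique (h3.congr fun m => ?_) (tendsto_const_nhds
    (x := unitCircle.integral (fun x => weight q 0 0 0 0 x / x) * qfac q q))).symm.trans ?_
  · rw [← hconst m]
    congr 1
    refine hΦ _ _ fun x => ?_
    rw [weight_zero_eq]
    simp [hval, X, Y, Z, div_eq_mul_inv]
  -- Expansion of `(1 - x²)(1 - x⁻²)/x`; only `2/x` has a nonzero integral.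
  · rw [mul_one, hΦ _ fun x => 2 * (x - 0)⁻¹ - ((x - 0) ^ (1 : ℤ) + (x - 0) ^ (-3 : ℤ))]
    · have c1 : ContinuousOn (fun x : ℂ => (x - 0)⁻¹) unitCircle.trace := by
        simpa using unitCircle.continuousOn_zpow h01 (-1)
      have c2 := unitCircle.continuousOn_zpow h01 1
      have c3 := unitCircle.continuousOn_zpow h01 (-3)
      rw [unitCircle.integral_sub (f := fun x => 2 * (x - 0)⁻¹)
          (g := fun x => (x - 0) ^ (1 : ℤ) + (x - 0) ^ (-3 : ℤ))
          (continuousOn_const.mul c1) (c2.add c3),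
        unitCircle.integral_add c2 c3, unitCircle.integral_const_mul,
        unitCircle.integral_zpow h01 (by norm_num), unitCircle.integral_zpow h01 (by norm_num),
        unitCircle.integral_inv_sub, unitCircle_winding_of_lt (by simp)]
      ring
    · intro x
      have := hx0 x
      simp only [ContinuousMap.mul_apply, ContinuousMap.sub_apply, ContinuousMap.one_apply, X, Y, Z,
        ContinuousMap.coe_mk, sub_zero, zpow_one]
      rw [show (-3 : ℤ) = -((3 : ℕ) : ℤ) from rfl, zpow_neg, zpow_natCast]
      field_simp
      ring

end NoParameters

/-! ### Application to the given contour. -/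

lemma IsContour.separates {q a b c d e : ℂ} {C : JordanCurve} (hC : IsContour q a b c d C)
    (he : e ∈ ({a, b, c, d} : Set ℂ)) : Separates C q e where
  inside k := ⟨(hC.mem_inside e he k).1, hC.counterclockwise _ (hC.mem_inside e he k)⟩
  outside _ k := by
    rw [mul_inv]
    exact ⟨(hC.mem_outside e he k).1, C.winding_eq_zero (hC.mem_outside e he k)⟩

lemma IsContour.separates_zero {q a b c d : ℂ} {C : JordanCurve} (hC : IsContour q a b c d C) :
    Separates C q 0 where
  inside k := by
    rw [zero_mul]
    exact ⟨hC.zero_inside.1, hC.counterclockwise _ hC.zero_inside⟩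
  outside h := absurd rfl h

end AskeyWilson

theorem theorem12p7 (q a b c d : ℂ) (hq0 : 0 < ‖q‖) (hq1 : ‖q‖ < 1)
    (ha : a ≠ 0) (hb : b ≠ 0) (hc : c ≠ 0) (hd : d ≠ 0)
    (hgen : ∀ e ∈ ({a, b, c, d} : Set ℂ), ∀ f ∈ ({a, b, c, d} : Set ℂ), ∀ n : ℤ, e * f ≠ q ^ n)
    (C : AskeyWilson.JordanCurve) (hC : AskeyWilson.IsContour q a b c d C) :
    AskeyWilson.form q a b c d C 1 1 =
      2 * AskeyWilson.qfac q (a * b * c * d) /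
        (AskeyWilson.qfac q q * AskeyWilson.qfac q (a * b) * AskeyWilson.qfac q (a * c) *
          AskeyWilson.qfac q (a * d) * AskeyWilson.qfac q (b * c) *
          AskeyWilson.qfac q (b * d) * AskeyWilson.qfac q (c * d)) := by
  have hq : q ≠ 0 := norm_pos_iff.1 hq0
  have h0 := hC.separates_zero
  have h1 := AskeyWilson.qfac_mul_integral_weight_zero hq1 hq h0 (hC.separates (e := a) (by simp))
    (hC.separates (e := b) (by simp)) (hC.separates (e := c) (by simp))
    (hC.separates (e := d) (by simp))
  have h2 := AskeyWilson.integral_weight_zero_mul_qfac hq1 hq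
  rw [AskeyWilson.integral_weight_zero_eq_unitCircle hq1 h0.zero_notMem h0.winding_zero] at h1
  -- A vanishing factor would force `e f = q^(-k)`, which genericity excludes.
  have hne : ∀ e ∈ ({a, b, c, d} : Set ℂ), ∀ f ∈ ({a, b, c, d} : Set ℂ),
      AskeyWilson.qfac q (e * f) ≠ 0 := fun e he f hf =>
    AskeyWilson.qfac_ne_zero hq1 fun k h => hgen e he f hf (-k) <| by
      rw [zpow_neg, zpow_natCast]
      exact eq_inv_of_mul_eq_one_left h
  have hqq : AskeyWilson.qfac q q ≠ 0 := AskeyWilson.qfac_ne_zero hq1 fun k h => by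
    rw [← pow_succ'] at h
    have := congrArg norm h
    rw [norm_pow, norm_one] at this
    exact (pow_lt_one₀ (norm_nonneg _) hq1 k.succ_ne_zero).ne this
  have n1 := hne a (by simp) b (by simp)
  have n2 := hne a (by simp) c (by simp)
  have n3 := hne a (by simp) d (by simp)
  have n4 := hne b (by simp) c (by simp)
  have n5 := hne b (by simp) d (by simp)
  have n6 := hne c (by simp) d (by simp)
  have hpi : (2 * Real.pi * Complex.I : ℂ) ≠ 0 := Complex.two_pi_I_ne_zero
  simp only [AskeyWilson.form, Pi.one_apply, one_mul]
  rw [eq_div_iff (by simp only [mul_ne_zero_iff]; tauto), one_div, mul_assoc,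
    inv_mul_eq_iff_eq_mul₀ hpi]
  linear_combination -AskeyWilson.qfac q q * h1 + AskeyWilson.qfac q (a * b * c * d) * h2
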